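/- Theorem 2. Let $\widetilde M(\mu)$ be a complex space form, i.e. a Kähler manifold $(\widetilde M,g,J)$ of constant holomorphic sectional curvature $\mu\in\mathbb R$ (no completeness is assumed), with Levi-Civita connection $\widetilde\nabla$. Let $M$ be a smooth (immersed) submanifold of $\widetilde M(\mu)$ with the induced metric, Levi-Civita connection $\nabla$, curvature tensor $R$ and scalar curvature $\tau$ (the full trace of $R$). Let $\sigma$ be its second fundamental form, $\sigma(X,Y)=(\widetilde\nabla_XY)^{\perp}$, let $D_X\xi=(\widetilde\nabla_X\xi)^{\perp}$ be the normal connection, with curvature tensor $R^\perp$, and for a normal vector $\xi$ let $f\xi$ be the normal component of $J\xi$. Assume that (a) $M$ is totally real: $J(T_pM)\subset (T_pM)^\perp$ for every $p\in M$; (b) $M$ is minimal: $\operatorname{tr}\sigma=0$; (c) $M$ is semiparallel: $R^\perp(X,Y)\sigma(Z,U)-\sigma(R(X,Y)Z,U)-\sigma(Z,R(X,Y)U)=0$ for all tangent $X,Y,Z,U$; (d) the $f$-structure in the normal bundle is parallel: $D_X(f\xi)=f(D_X\xi)$ for all tangent fields $X$ and normal fields $\xi$ (the case $f=0$ is allowed).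 Then the squared length $\|\sigma\|^2$ of the second fundamental form is constant on $M$ if and only if $\tau$ is constant on $M$. If this is the case, then $M$ is totally geodesic (i.e. $\sigma=0$) or $\tau\ge 0$; moreover, if $\tau=0$, then $M$ is flat (i.e. $R=0$). -/

import Mathlib

open scoped Manifold ContDiff Topology
open Bundle Filter

noncomputable section

namespace TotReal

/-! ### Local Riemannian geometry in a coordinate domain -/

section Local

variable {V : Type*} [NormedAddCommGroup V] [NormedSpace ℝ V] [FiniteDimensional ℝ V]
variable {W : Type*} [NormedAddCommGroup W] [NormedSpace ℝ W] [FiniteDimensional ℝ W]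

/-- The Christoffel symbol `Γ_x(v, w)` of the metric `g`: the vector whose `g`-product with `t` is
`((∂_v g)(w, t) + (∂_w g)(v, t) - (∂_t g)(v, w)) / 2`. -/
def christoffel (g : V → V →L[ℝ] V →L[ℝ] ℝ) (x v w : V) : V :=
  (g x).inverse ((1 / 2 : ℝ) •
    (fderiv ℝ g x v w + fderiv ℝ g x w v - ((fderiv ℝ g x).flip v).flip w))

/-- The Levi-Civita derivative `∇_v Y` at `x` of a vector field `Y`. -/
def cov (g : V → V →L[ℝ] V →L[ℝ] ℝ) (Y : V → V) (x v : V) : V :=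
  fderiv ℝ Y x v + christoffel g x v (Y x)

/-- The curvature tensor `R_x(v, w) z = ∇_v ∇_w z - ∇_w ∇_v z`, computed on the constant
(coordinate) extensions of `v, w, z`; their brackets vanish. -/
def curv (g : V → V →L[ℝ] V →L[ℝ] ℝ) (x v w z : V) : V :=
  cov g (fun y => cov g (fun _ => z) y w) x v - cov g (fun y => cov g (fun _ => z) y v) x w

/-- The trace `∑ g^{ij} B(b_i, b_j)` of a bilinear map `B` with respect to an inner product `g`
(equal to `∑ B(e_i, e_i)` for every `g`-orthonormal basis `e`). The second argument is `b_i` with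
the index raised: `g.inverse` sends the dual basis covector `b^i` to `∑_j g^{ij} b_j`. -/
def metricTrace {Z : Type*} [AddCommMonoid Z] (g : V →L[ℝ] V →L[ℝ] ℝ) (B : V → V → Z) : Z :=
  ∑ i, B (Module.finBasis ℝ V i)
    (g.inverse (LinearMap.toContinuousLinearMap ((Module.finBasis ℝ V).coord i)))

/-- The Ricci tensor `Ric_x(v, w)`, the trace of `a ↦ R(a, v) w`. -/
def ricci (g : V → V →L[ℝ] V →L[ℝ] ℝ) (x v w : V) : ℝ :=
  metricTrace (g x) (fun a b => g x (curv g x a v w) b)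

/-- The scalar curvature. -/
def scalarCurv (g : V → V →L[ℝ] V →L[ℝ] ℝ) (x : V) : ℝ :=
  metricTrace (g x) (ricci g x)

/-- The sectional curvature of the plane spanned by `v` and `w`. -/
def sectionalCurv (g : V → V →L[ℝ] V →L[ℝ] ℝ) (x v w : V) : ℝ :=
  g x (curv g x v w w) v / (g x v v * g x w w - g x v w ^ 2)

/-- The metric induced on `V` by `u : V → W` from the metric `G` on `W`. -/
def inducedMetric (G : W → W →L[ℝ] W →L[ℝ] ℝ) (u : V → W) (x : V) : V →L[ℝ] V →L[ℝ] ℝ :=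
  (G (u x)).bilinearComp (fderiv ℝ u x) (fderiv ℝ u x)

/-- The ambient Levi-Civita derivative `∇̃_v ξ` at `x` of a vector field `ξ` along `u`. -/
def covAlong (G : W → W →L[ℝ] W →L[ℝ] ℝ) (u : V → W) (ξ : V → W) (x v : V) : W :=
  fderiv ℝ ξ x v + christoffel G (u x) (fderiv ℝ u x v) (ξ x)

/-- The tangential component of `a` at `u x`, as a vector of `V`: the `t` such that
`G(du t, du s) = G(a, du s)` for all `s`. -/
def tangentialPart (G : W → W →L[ℝ] W →L[ℝ] ℝ) (u : V → W) (x : V) (a : W) : V :=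
  (inducedMetric G u x).inverse ((G (u x) a).comp (fderiv ℝ u x))

/-- The normal component of `a` at `u x`. -/
def normalPart (G : W → W →L[ℝ] W →L[ℝ] ℝ) (u : V → W) (x : V) (a : W) : W :=
  a - fderiv ℝ u x (tangentialPart G u x a)

/-- The second fundamental form `σ_x(v, w)`, the normal component of `∇̃_v (du w)`. -/
def sff (G : W → W →L[ℝ] W →L[ℝ] ℝ) (u : V → W) (x v w : V) : W :=
  normalPart G u x (covAlong G u (fun y => fderiv ℝ u y w) x v)

/-- The mean curvature vector `H = (1/n) tr σ`. -/
def meanCurv (G : W → W →L[ℝ] W →L[ℝ] ℝ) (u : V → W) (x : V) : W :=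
  (1 / (Module.finrank ℝ V : ℝ)) • metricTrace (inducedMetric G u x) (sff G u x)

/-- The squared length of the second fundamental form. -/
def sffNormSq (G : W → W →L[ℝ] W →L[ℝ] ℝ) (u : V → W) (x : V) : ℝ :=
  metricTrace (inducedMetric G u x) (fun v v' =>
    metricTrace (inducedMetric G u x) (fun w w' => G (u x) (sff G u x v w) (sff G u x v' w')))

/-- The normal connection `D_v ξ`, the normal component of `∇̃_v ξ`. -/
def normalCov (G : W → W →L[ℝ] W →L[ℝ] ℝ) (u : V → W) (ξ : V → W) (x v : V) : W :=
  normalPart G u x (covAlong G u ξ x v)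

/-- The curvature `R^⊥(v, w) ξ = D_v D_w ξ - D_w D_v ξ` of the normal connection, for the constant
(hence commuting) extensions of `v` and `w` and a normal field `ξ`. -/
def normalCurv (G : W → W →L[ℝ] W →L[ℝ] ℝ) (u : V → W) (ξ : V → W) (x v w : V) : W :=
  normalCov G u (fun y => normalCov G u ξ y w) x v
    - normalCov G u (fun y => normalCov G u ξ y v) x w

/-- `ξ` is a smooth normal vector field along `u` near `x`. -/
def IsNormalFieldAt (G : W → W →L[ℝ] W →L[ℝ] ℝ) (u : V → W) (ξ : V → W) (x : V) : Prop :=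
  ContDiffAt ℝ ∞ ξ x ∧ ∀ᶠ y in 𝓝 x, ∀ v : V, G (u y) (ξ y) (fderiv ℝ u y v) = 0

/-- `f a`, the normal component of `J a`. -/
def normalF (G : W → W →L[ℝ] W →L[ℝ] ℝ) (J : W → W →L[ℝ] W) (u : V → W) (x : V) (a : W) : W :=
  normalPart G u x (J (u x) a)

/-- `Df = 0` at `x`: `D_v (f ξ) = f (D_v ξ)` for all normal fields `ξ` and all `v`. -/
def ParallelFAt (G : W → W →L[ℝ] W →L[ℝ] ℝ) (J : W → W →L[ℝ] W) (u : V → W) (x : V) : Prop :=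
  ∀ ξ : V → W, IsNormalFieldAt G u ξ x → ∀ v : V,
    normalCov G u (fun y => normalF G J u y (ξ y)) x v = normalF G J u x (normalCov G u ξ x v)

/-- `R̄ · σ = 0` at `x`: `R^⊥(v, w) σ(z, t) - σ(R(v, w) z, t) - σ(z, R(v, w) t) = 0`, where `R` is
the curvature of the induced metric. -/
def SemiparallelAt (G : W → W →L[ℝ] W →L[ℝ] ℝ) (u : V → W) (x : V) : Prop :=
  ∀ v w z t : V,
    normalCurv G u (fun y => sff G u y z t) x v w
      - sff G u x (curv (inducedMetric G u) x v w z) t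
      - sff G u x z (curv (inducedMetric G u) x v w t) = 0

end Local

/-! ### Kähler manifolds and complex space forms -/

section Ambient

variable {E' : Type*} [NormedAddCommGroup E'] [NormedSpace ℝ E'] [FiniteDimensional ℝ E']
variable {N : Type*} [TopologicalSpace N] [ChartedSpace E' N] [IsManifold 𝓘(ℝ, E') ∞ N]

/-- The metric read in the preferred chart at `q`. -/
def chartMetric (g : ContMDiffRiemannianMetric 𝓘(ℝ, E') ∞ E' (fun q : N => TangentSpace 𝓘(ℝ, E') q))
    (q : N) (y : E') : E' →L[ℝ] E' →L[ℝ] ℝ :=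
  let B : E' →L[ℝ] E' →L[ℝ] ℝ := g.inner ((extChartAt 𝓘(ℝ, E') q).symm y)
  let L : E' →L[ℝ] E' := mfderiv 𝓘(ℝ, E') 𝓘(ℝ, E') (extChartAt 𝓘(ℝ, E') q).symm y
  B.bilinearComp L L

/-- A field of endomorphisms of the tangent spaces, read in the preferred chart at `q`. -/
def chartEnd (J : ∀ q : N, TangentSpace 𝓘(ℝ, E') q →L[ℝ] TangentSpace 𝓘(ℝ, E') q)
    (q : N) (y : E') : E' →L[ℝ] E' :=
  (mfderiv 𝓘(ℝ, E') 𝓘(ℝ, E') (extChartAt 𝓘(ℝ, E') q) ((extChartAt 𝓘(ℝ, E') q).symm y)).comp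
    ((J ((extChartAt 𝓘(ℝ, E') q).symm y)).comp
      (mfderiv 𝓘(ℝ, E') 𝓘(ℝ, E') (extChartAt 𝓘(ℝ, E') q).symm y))

/-- `(g, J)` is a Kähler structure on `N`: `J` is a smooth almost complex structure, `g` is
Hermitian, and `∇̃ J = 0` for the Levi-Civita connection of `g` (written in charts, on constant
fields: `∇̃_v (J w) = J (∇̃_v w)`). -/
structure IsKahler
    (g : ContMDiffRiemannianMetric 𝓘(ℝ, E') ∞ E' (fun q : N => TangentSpace 𝓘(ℝ, E') q))
    (J : ∀ q : N, TangentSpace 𝓘(ℝ, E') q →L[ℝ] TangentSpace 𝓘(ℝ, E') q) : Prop where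
  smooth : ContMDiff 𝓘(ℝ, E') (𝓘(ℝ, E').prod 𝓘(ℝ, E' →L[ℝ] E')) ∞
    (fun q => TotalSpace.mk' (E' →L[ℝ] E')
      (E := fun q : N => TangentSpace 𝓘(ℝ, E') q →L[ℝ] TangentSpace 𝓘(ℝ, E') q) q (J q))
  sq : ∀ (q : N) (a : TangentSpace 𝓘(ℝ, E') q), J q (J q a) = -a
  hermitian : ∀ (q : N) (a b : TangentSpace 𝓘(ℝ, E') q),
    g.inner q (J q a) (J q b) = g.inner q a b
  parallel : ∀ (q : N), ∀ y ∈ (extChartAt 𝓘(ℝ, E') q).target, ∀ v w : E',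
    cov (chartMetric g q) (fun y' => chartEnd J q y' w) y v
      = chartEnd J q y (cov (chartMetric g q) (fun _ => w) y v)

/-- `(N, g, J)` is a complex space form of constant holomorphic sectional curvature `μ`: it is
Kähler and every plane spanned by `a ≠ 0` and `J a` has sectional curvature `μ`. The tangent space
at `q` is identified with `E'` through the preferred chart at `q`. -/
structure IsComplexSpaceForm
    (g : ContMDiffRiemannianMetric 𝓘(ℝ, E') ∞ E' (fun q : N => TangentSpace 𝓘(ℝ, E') q))
    (J : ∀ q : N, TangentSpace 𝓘(ℝ, E') q →L[ℝ] TangentSpace 𝓘(ℝ, E') q) (μ : ℝ) : Prop where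
  kahler : IsKahler g J
  holomorphicCurv : ∀ (q : N) (a : TangentSpace 𝓘(ℝ, E') q), a ≠ 0 →
    sectionalCurv (chartMetric g q) (extChartAt 𝓘(ℝ, E') q q) a (J q a) = μ

end Ambient

/-! ### Submanifolds: immersions `F : M → N`, with the induced metric on `M` -/

section Submanifold

variable {E : Type*} [NormedAddCommGroup E] [NormedSpace ℝ E] [FiniteDimensional ℝ E]
variable {M : Type*} [TopologicalSpace M] [ChartedSpace E M] [IsManifold 𝓘(ℝ, E) ∞ M]
variable {E' : Type*} [NormedAddCommGroup E'] [NormedSpace ℝ E'] [FiniteDimensional ℝ E']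
variable {N : Type*} [TopologicalSpace N] [ChartedSpace E' N] [IsManifold 𝓘(ℝ, E') ∞ N]

/-- `F` is a smooth immersion. -/
def IsSmoothImmersion (F : M → N) : Prop :=
  ContMDiff 𝓘(ℝ, E) 𝓘(ℝ, E') ∞ F ∧
    ∀ p : M, Function.Injective (mfderiv 𝓘(ℝ, E) 𝓘(ℝ, E') F p)

/-- `J (T_p M)` is orthogonal to `T_p M` for every `p`. -/
def IsTotallyReal
    (g : ContMDiffRiemannianMetric 𝓘(ℝ, E') ∞ E' (fun q : N => TangentSpace 𝓘(ℝ, E') q))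
    (J : ∀ q : N, TangentSpace 𝓘(ℝ, E') q →L[ℝ] TangentSpace 𝓘(ℝ, E') q) (F : M → N) : Prop :=
  ∀ (p : M) (v w : TangentSpace 𝓘(ℝ, E) p),
    g.inner (F p) (J (F p) (mfderiv 𝓘(ℝ, E) 𝓘(ℝ, E') F p v)) (mfderiv 𝓘(ℝ, E) 𝓘(ℝ, E') F p w) = 0

/-- `H = 0`. -/
def IsMinimal
    (g : ContMDiffRiemannianMetric 𝓘(ℝ, E') ∞ E' (fun q : N => TangentSpace 𝓘(ℝ, E') q))
    (F : M → N) : Prop :=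
  ∀ p : M, meanCurv (chartMetric g (F p)) (writtenInExtChartAt 𝓘(ℝ, E) 𝓘(ℝ, E') p F)
    (extChartAt 𝓘(ℝ, E) p p) = 0

/-- `σ = 0`. -/
def IsTotallyGeodesic
    (g : ContMDiffRiemannianMetric 𝓘(ℝ, E') ∞ E' (fun q : N => TangentSpace 𝓘(ℝ, E') q))
    (F : M → N) : Prop :=
  ∀ (p : M) (v w : TangentSpace 𝓘(ℝ, E) p),
    sff (chartMetric g (F p)) (writtenInExtChartAt 𝓘(ℝ, E) 𝓘(ℝ, E') p F)
      (extChartAt 𝓘(ℝ, E) p p) v w = 0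

/-- `R̄ · σ = 0`. -/
def IsSemiparallel
    (g : ContMDiffRiemannianMetric 𝓘(ℝ, E') ∞ E' (fun q : N => TangentSpace 𝓘(ℝ, E') q))
    (F : M → N) : Prop :=
  ∀ p : M, SemiparallelAt (chartMetric g (F p)) (writtenInExtChartAt 𝓘(ℝ, E) 𝓘(ℝ, E') p F)
    (extChartAt 𝓘(ℝ, E) p p)

/-- The `f`-structure in the normal bundle is parallel, `Df = 0`. -/
def HasParallelF
    (g : ContMDiffRiemannianMetric 𝓘(ℝ, E') ∞ E' (fun q : N => TangentSpace 𝓘(ℝ, E') q))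
    (J : ∀ q : N, TangentSpace 𝓘(ℝ, E') q →L[ℝ] TangentSpace 𝓘(ℝ, E') q) (F : M → N) : Prop :=
  ∀ p : M, ParallelFAt (chartMetric g (F p)) (chartEnd J (F p))
    (writtenInExtChartAt 𝓘(ℝ, E) 𝓘(ℝ, E') p F) (extChartAt 𝓘(ℝ, E) p p)

/-- The squared length of the second fundamental form, as a function on `M`. -/
def sffLengthSq
    (g : ContMDiffRiemannianMetric 𝓘(ℝ, E') ∞ E' (fun q : N => TangentSpace 𝓘(ℝ, E') q))
    (F : M → N) (p : M) : ℝ :=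
  sffNormSq (chartMetric g (F p)) (writtenInExtChartAt 𝓘(ℝ, E) 𝓘(ℝ, E') p F)
    (extChartAt 𝓘(ℝ, E) p p)

/-- The scalar curvature of the induced metric, as a function on `M`. -/
def scalarCurvature
    (g : ContMDiffRiemannianMetric 𝓘(ℝ, E') ∞ E' (fun q : N => TangentSpace 𝓘(ℝ, E') q))
    (F : M → N) (p : M) : ℝ :=
  scalarCurv (inducedMetric (chartMetric g (F p)) (writtenInExtChartAt 𝓘(ℝ, E) 𝓘(ℝ, E') p F))
    (extChartAt 𝓘(ℝ, E) p p)

/-- The curvature tensor of the induced metric vanishes. -/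
def IsFlat
    (g : ContMDiffRiemannianMetric 𝓘(ℝ, E') ∞ E' (fun q : N => TangentSpace 𝓘(ℝ, E') q))
    (F : M → N) : Prop :=
  ∀ (p : M) (v w z : TangentSpace 𝓘(ℝ, E) p),
    curv (inducedMetric (chartMetric g (F p)) (writtenInExtChartAt 𝓘(ℝ, E) 𝓘(ℝ, E') p F))
      (extChartAt 𝓘(ℝ, E) p p) v w z = 0

end Submanifold

end TotReal

end

/-! Everything is decided at one point `p`, in charts. Since `M` is totally real, `J w` is normal
for tangent `w`. Differentiating a normal field that extends `J w` and comparing with `D f = 0`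
gives `σ(v, w) = J a`, where `a` is, up to sign, the tangential derivative of that field
(`exists_shape`). Hence `σ` takes values in `J(TM)`, and the cubic form `C(v, w, t) = ⟨σ(v, w), J
t⟩` carries all of `σ` and is totally symmetric. Minimality makes `C` trace-free.

Write `n = dim M`, `c = μ / 4`, `S = |C|² = ‖σ‖²`. The ambient curvature is the standard model
(`curv_of_holomorphic`), whose `J`-terms vanish on tangent vectors, so the Gauss equation reads `R =
c • unitCurv + cubicCurv C`. Tracing gives `τ = n(n-1)c - S`, and the equivalence of the two
constancy statements follows.

For the rest, the Ricci equation turns semiparallelity into the algebraic statement that `R`, acting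
as a derivation, annihilates `C` (`isSemiparallelCubic`). Contracting with `C` yields a Simons-type
identity `|cubicCurv|² + |cubicGram|² = (n+1) c S` (`simons`). Bounding both squares below by their
components along `unitCurv` and the identity matrix gives `S ≤ n(n-1)c` whenever `S ≠ 0`, that is,
`τ ≥ 0`. If `τ = 0`, the same estimates force `|R|² ≤ 0`. Constancy of `‖σ‖²` is needed only to
ensure that `S` vanishes everywhere or nowhere. -/

noncomputable section

set_option linter.unusedSectionVars false
set_option maxSynthPendingDepth 3

namespace TotReal

/-! ### Levi-Civita calculus in coordinates, for vector fields along a map. -/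

section MetricCalculus

variable {V : Type*} [NormedAddCommGroup V] [NormedSpace ℝ V] [FiniteDimensional ℝ V]
variable {W : Type*} [NormedAddCommGroup W] [NormedSpace ℝ W] [FiniteDimensional ℝ W]

/-- A definite bilinear form on a finite-dimensional space is invertible as a map to the dual. -/
theorem isInvertible_of_pos {B : V →L[ℝ] V →L[ℝ] ℝ} (hB : ∀ v, v ≠ 0 → 0 < B v v) :
    B.IsInvertible := by
  have hinj : Function.Injective B := by
    rw [injective_iff_map_eq_zero]
    intro v hv
    by_contra h
    have := hB v h
    simp [hv] at this
  have hrank : Module.finrank ℝ V = Module.finrank ℝ (V →L[ℝ] ℝ) := by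
    rw [← (LinearMap.toContinuousLinearMap (𝕜 := ℝ) (E := V) (F' := ℝ)).finrank_eq]
    exact (Subspace.dual_finrank_eq (K := ℝ) (V := V)).symm
  let e : V ≃ₗ[ℝ] (V →L[ℝ] ℝ) :=
    LinearEquiv.ofInjectiveOfFinrankEq (B : V →ₗ[ℝ] (V →L[ℝ] ℝ)) hinj hrank
  exact ⟨e.toContinuousLinearEquiv, by ext v w; rfl⟩

/-- `g` is a smooth Riemannian metric on the open set `Ω`. -/
structure IsMetricOn (g : V → V →L[ℝ] V →L[ℝ] ℝ) (Ω : Set V) : Prop where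
  isOpen : IsOpen Ω
  contDiffAt : ∀ x ∈ Ω, ContDiffAt ℝ ∞ g x
  symm : ∀ x ∈ Ω, ∀ v w, g x v w = g x w v
  pos : ∀ x ∈ Ω, ∀ v, v ≠ 0 → 0 < g x v v

/-- The Christoffel symbols of `g` as a bilinear map. -/
def connForm (g : V → V →L[ℝ] V →L[ℝ] ℝ) (x : V) : V →L[ℝ] V →L[ℝ] V :=
  (ContinuousLinearMap.compL ℝ V (V →L[ℝ] ℝ) V (g x).inverse).comp
    ((1 / 2 : ℝ) • (fderiv ℝ g x + (fderiv ℝ g x).flip -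
      (ContinuousLinearMap.flipₗᵢ ℝ V V ℝ).toContinuousLinearEquiv.toContinuousLinearMap.comp
        (fderiv ℝ g x).flip))

theorem christoffel_eq (g : V → V →L[ℝ] V →L[ℝ] ℝ) (x v w : V) :
    christoffel g x v w = connForm g x v w := rfl

variable {g : V → V →L[ℝ] V →L[ℝ] ℝ} {Ω : Set V} {x : V}

namespace IsMetricOn

theorem isInvertible (hg : IsMetricOn g Ω) (hx : x ∈ Ω) : (g x).IsInvertible :=
  isInvertible_of_pos (hg.pos x hx)

theorem eq_of_apply_eq (hg : IsMetricOn g Ω) (hx : x ∈ Ω) {a b : V}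
    (h : ∀ t, g x a t = g x b t) : a = b :=
  (hg.isInvertible hx).injective (ContinuousLinearMap.ext h)

theorem contDiffAt_fderiv (hg : IsMetricOn g Ω) (hx : x ∈ Ω) : ContDiffAt ℝ ∞ (fderiv ℝ g) x :=
  (hg.contDiffAt x hx).fderiv_right (by simp)

theorem contDiffAt_inverse (hg : IsMetricOn g Ω) (hx : x ∈ Ω) :
    ContDiffAt ℝ ∞ (fun y => (g y).inverse) x :=
  ((hg.isInvertible hx).contDiffAt_map_inverse).comp x (hg.contDiffAt x hx)

set_option synthInstance.maxHeartbeats 100000 in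
theorem contDiffAt_connForm (hg : IsMetricOn g Ω) (hx : x ∈ Ω) :
    ContDiffAt ℝ ∞ (connForm g) x := by
  have h1 := hg.contDiffAt_inverse hx
  have h2 := hg.contDiffAt_fderiv hx
  have h3 : ContDiffAt ℝ ∞ (fun y => (fderiv ℝ g y).flip) x :=
    (ContinuousLinearMap.flipₗᵢ ℝ V V (V →L[ℝ] ℝ)).contDiff.contDiffAt.comp x h2
  unfold connForm
  refine ContDiffAt.clm_comp ?_ ?_
  · exact (ContinuousLinearMap.contDiff _).contDiffAt.comp x h1
  · exact ((h2.add h3).sub (contDiffAt_const.clm_comp h3)).const_smul _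

/-- Koszul's formula for coordinate fields. Metric compatibility and vanishing torsion are both read
off from it. -/
theorem apply_connForm (hg : IsMetricOn g Ω) (hx : x ∈ Ω) (v w t : V) :
    g x (connForm g x v w) t =
      (fderiv ℝ g x v w t + fderiv ℝ g x w v t - fderiv ℝ g x t v w) / 2 := by
  rw [← christoffel_eq, christoffel, (hg.isInvertible hx).self_apply_inverse]
  simp
  ring

theorem fderiv_symm (hg : IsMetricOn g Ω) (hx : x ∈ Ω) (v w t : V) :
    fderiv ℝ g x v w t = fderiv ℝ g x v t w := by
  have hd : DifferentiableAt ℝ g x := (hg.contDiffAt x hx).differentiableAt (by simp)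
  have h : (fun y => g y w t) =ᶠ[𝓝 x] fun y => g y t w := by
    filter_upwards [hg.isOpen.mem_nhds hx] with y hy using hg.symm y hy w t
  have h1 : ∀ a b, fderiv ℝ (fun y => g y a b) x v = fderiv ℝ g x v a b := by
    intro a b
    have := ((hd.hasFDerivAt.clm_apply (hasFDerivAt_const a x)).clm_apply
      (hasFDerivAt_const b x)).fderiv
    simp [this]
  rw [← h1, ← h1, h.fderiv_eq]

theorem connForm_symm (hg : IsMetricOn g Ω) (hx : x ∈ Ω) (v w : V) :
    connForm g x v w = connForm g x w v := by
  refine hg.eq_of_apply_eq hx fun t => ?_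
  rw [hg.apply_connForm hx, hg.apply_connForm hx, hg.fderiv_symm hx t v w]
  ring

theorem fderiv_apply (hg : IsMetricOn g Ω) (hx : x ∈ Ω) (v a b : V) :
    fderiv ℝ g x v a b = g x (connForm g x v a) b + g x a (connForm g x v b) := by
  rw [hg.symm x hx a, hg.apply_connForm hx, hg.apply_connForm hx, hg.fderiv_symm hx a v b,
    hg.fderiv_symm hx b v a, hg.fderiv_symm hx v b a]
  ring

end IsMetricOn

theorem cov_const (g : V → V →L[ℝ] V →L[ℝ] ℝ) (x v z : V) :
    cov g (fun _ => z) x v = connForm g x v z := by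
  simp [cov, christoffel_eq]

/-- Taking `u = id` makes the intrinsic connection a case of the connection along a map, so the
curvature identities below reuse the lemmas on `covAlong`. -/
theorem covAlong_id (g : V → V →L[ℝ] V →L[ℝ] ℝ) (Y : V → V) (x v : V) :
    covAlong g id Y x v = cov g Y x v := by
  simp [cov, covAlong]

theorem covAlong_congr {G : W → W →L[ℝ] W →L[ℝ] ℝ} {u ξ η : V → W}
    (h : ξ =ᶠ[𝓝 x] η) (v : V) : covAlong G u ξ x v = covAlong G u η x v := by
  simp [covAlong, h.fderiv_eq, h.eq_of_nhds]

theorem covAlong_add {G : W → W →L[ℝ] W →L[ℝ] ℝ} {u ξ η : V → W}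
    (hξ : DifferentiableAt ℝ ξ x) (hη : DifferentiableAt ℝ η x) (v : V) :
    covAlong G u (fun y => ξ y + η y) x v = covAlong G u ξ x v + covAlong G u η x v := by
  simp only [covAlong, christoffel_eq, fderiv_fun_add hξ hη, map_add, add_apply]
  abel

theorem covAlong_sub {G : W → W →L[ℝ] W →L[ℝ] ℝ} {u ξ η : V → W}
    (hξ : DifferentiableAt ℝ ξ x) (hη : DifferentiableAt ℝ η x) (v : V) :
    covAlong G u (fun y => ξ y - η y) x v = covAlong G u ξ x v - covAlong G u η x v := by
  simp only [covAlong, christoffel_eq, fderiv_fun_sub hξ hη, map_sub, sub_apply]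
  abel

variable {G : W → W →L[ℝ] W →L[ℝ] ℝ} {Θ : Set W} {u ξ η : V → W}

theorem contDiffAt_fderiv_apply (hξ : ContDiffAt ℝ ∞ ξ x) (v : V) :
    ContDiffAt ℝ ∞ (fun y => fderiv ℝ ξ y v) x :=
  (hξ.fderiv_right (m := ∞) (by simp)).clm_apply contDiffAt_const

theorem fderiv_fderiv_symm (hξ : ContDiffAt ℝ ∞ ξ x) (v w : V) :
    fderiv ℝ (fderiv ℝ ξ) x v w = fderiv ℝ (fderiv ℝ ξ) x w v :=
  (hξ.isSymmSndFDerivAt (by simpa using ENat.LEInfty.out)).eq v w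

namespace IsMetricOn

theorem contDiffAt_covAlong (hG : IsMetricOn G Θ) (hu : ContDiffAt ℝ ∞ u x) (hx : u x ∈ Θ)
    (hξ : ContDiffAt ℝ ∞ ξ x) (v : V) : ContDiffAt ℝ ∞ (fun y => covAlong G u ξ y v) x := by
  simp only [covAlong, christoffel_eq]
  exact (contDiffAt_fderiv_apply hξ v).add
    ((((hG.contDiffAt_connForm hx).comp x hu).clm_apply (contDiffAt_fderiv_apply hu v)).clm_apply hξ)

/-- The Levi-Civita connection along a map is compatible with the metric. -/
theorem fderiv_inner (hG : IsMetricOn G Θ) (hu : ContDiffAt ℝ ∞ u x) (hx : u x ∈ Θ)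
    (hξ : DifferentiableAt ℝ ξ x) (hη : DifferentiableAt ℝ η x) (v : V) :
    fderiv ℝ (fun y => G (u y) (ξ y) (η y)) x v =
      G (u x) (covAlong G u ξ x v) (η x) + G (u x) (ξ x) (covAlong G u η x v) := by
  have hud : DifferentiableAt ℝ u x := hu.differentiableAt (by simp)
  have hGd : DifferentiableAt ℝ G (u x) := (hG.contDiffAt _ hx).differentiableAt (by simp)
  have := (((hGd.hasFDerivAt.comp x hud.hasFDerivAt).clm_apply hξ.hasFDerivAt).clm_apply
    hη.hasFDerivAt).fderiv
  simp only [Function.comp_apply] at this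
  rw [this]
  simp [covAlong, christoffel_eq, hG.fderiv_apply hx]
  ring

/-- The product rule, with the second derivatives of `ξ` and `u` isolated: these are symmetric in
`v, w` and cancel in commutators. -/
theorem fderiv_covAlong (hG : IsMetricOn G Θ) (hu : ContDiffAt ℝ ∞ u x) (hx : u x ∈ Θ)
    (hξ : ContDiffAt ℝ ∞ ξ x) (v w : V) :
    fderiv ℝ (fun y => covAlong G u ξ y w) x v =
      fderiv ℝ (fderiv ℝ ξ) x v w
      + (fderiv ℝ (connForm G) (u x) (fderiv ℝ u x v) (fderiv ℝ u x w) (ξ x)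
      + connForm G (u x) (fderiv ℝ (fderiv ℝ u) x v w) (ξ x)
      + connForm G (u x) (fderiv ℝ u x w) (fderiv ℝ ξ x v)) := by
  have hud : DifferentiableAt ℝ u x := hu.differentiableAt (by simp)
  have hξd : DifferentiableAt ℝ ξ x := hξ.differentiableAt (by simp)
  have hu2 : DifferentiableAt ℝ (fderiv ℝ u) x :=
    (hu.fderiv_right (m := ∞) (by simp)).differentiableAt (by simp)
  have hξ2 : DifferentiableAt ℝ (fderiv ℝ ξ) x :=
    (hξ.fderiv_right (m := ∞) (by simp)).differentiableAt (by simp)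
  have hΓ : DifferentiableAt ℝ (connForm G) (u x) :=
    (hG.contDiffAt_connForm hx).differentiableAt (by simp)
  have := ((hξ2.hasFDerivAt.clm_apply (hasFDerivAt_const w x)).add
    (((hΓ.hasFDerivAt.comp x hud.hasFDerivAt).clm_apply
      (hu2.hasFDerivAt.clm_apply (hasFDerivAt_const w x))).clm_apply hξd.hasFDerivAt)).fderiv
  simp only [Function.comp_apply] at this
  simp only [covAlong, christoffel_eq]
  erw [this]
  simp
  abel

theorem curv_eq (hG : IsMetricOn g Ω) (hx : x ∈ Ω) (v w z : V) :
    curv g x v w z =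
      fderiv ℝ (connForm g) x v w z - fderiv ℝ (connForm g) x w v z
      + connForm g x v (connForm g x w z) - connForm g x w (connForm g x v z) := by
  have key : ∀ v w, cov g (fun y => cov g (fun _ => z) y w) x v =
      fderiv ℝ (connForm g) x v w z + connForm g x v (connForm g x w z) := by
    intro v w
    have h := hG.fderiv_covAlong (u := id) (ξ := fun _ : V => z) (x := x) contDiffAt_id hx
      contDiffAt_const v w
    simp only [covAlong_id] at h
    rw [cov, h, christoffel_eq, cov_const]
    have h0 : fderiv ℝ (fderiv ℝ (id : V → V)) x = 0 := by
      have : fderiv ℝ (id : V → V) = fun _ => ContinuousLinearMap.id ℝ V := funext fun _ => fderiv_id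
      rw [this]
      exact fderiv_const_apply _
    simp [fderiv_id, h0]
  rw [curv, key, key]
  abel

/-- Covariant derivatives along a map commute up to the ambient curvature. -/
theorem covAlong_comm (hG : IsMetricOn G Θ) (hu : ContDiffAt ℝ ∞ u x) (hx : u x ∈ Θ)
    (hξ : ContDiffAt ℝ ∞ ξ x) (v w : V) :
    covAlong G u (fun y => covAlong G u ξ y w) x v - covAlong G u (fun y => covAlong G u ξ y v) x w
      = curv G (u x) (fderiv ℝ u x v) (fderiv ℝ u x w) (ξ x) := by
  rw [hG.curv_eq hx]
  have e : ∀ v w, covAlong G u (fun y => covAlong G u ξ y w) x v =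
    fderiv ℝ (fun y => covAlong G u ξ y w) x v
      + connForm G (u x) (fderiv ℝ u x v) (covAlong G u ξ x w) := fun _ _ => rfl
  rw [e, e, hG.fderiv_covAlong hu hx hξ, hG.fderiv_covAlong hu hx hξ,
    fderiv_fderiv_symm hξ v w, fderiv_fderiv_symm hu v w]
  simp only [covAlong, christoffel_eq, map_add]
  abel

theorem curv_antisymm (x v w z : V) : curv g x v w z = - curv g x w v z := by
  simp [curv]

/-- In the coordinate formula `curv_eq` the cyclic sum cancels termwise, because the Christoffel
symbols and their derivatives are symmetric in the two lower slots. -/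
theorem curv_bianchi (hg : IsMetricOn g Ω) (hx : x ∈ Ω) (v w z : V) :
    curv g x v w z + curv g x w z v + curv g x z v w = 0 := by
  have hΓ : DifferentiableAt ℝ (connForm g) x :=
    (hg.contDiffAt_connForm hx).differentiableAt (by simp)
  have h1 : ∀ a b, fderiv ℝ (fun y => connForm g y a b) x = fun t => fderiv ℝ (connForm g) x t a b := by
    intro a b
    have := ((hΓ.hasFDerivAt.clm_apply (hasFDerivAt_const a x)).clm_apply
      (hasFDerivAt_const b x)).fderiv
    ext t
    simp [this]
  have h2 : ∀ t a b, fderiv ℝ (connForm g) x t a b = fderiv ℝ (connForm g) x t b a := by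
    intro t a b
    have h : (fun y => connForm g y a b) =ᶠ[𝓝 x] fun y => connForm g y b a := by
      filter_upwards [hg.isOpen.mem_nhds hx] with y hy using hg.connForm_symm hy a b
    rw [← congrFun (h1 a b) t, ← congrFun (h1 b a) t, h.fderiv_eq]
  rw [hg.curv_eq hx, hg.curv_eq hx, hg.curv_eq hx, h2 v w z, h2 w z v, h2 z v w,
    hg.connForm_symm hx z v, hg.connForm_symm hx w v, hg.connForm_symm hx z w]
  abel

/-- The second derivative of the function `g(z, t)` is symmetric. Expanding it by metric
compatibility, the mixed first-order terms are symmetric by themselves, and the antisymmetrized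
remainder is `⟨R z, t⟩ + ⟨z, R t⟩ = 0`. -/
theorem curv_skew (hg : IsMetricOn g Ω) (hx : x ∈ Ω) (v w z t : V) :
    g x (curv g x v w z) t = - g x (curv g x v w t) z := by
  have hc : ∀ z : V, ContDiffAt ℝ ∞ (fun _ : V => z) x := fun _ => contDiffAt_const
  have hi : ContDiffAt ℝ ∞ (id : V → V) x := contDiffAt_id
  have hd : ∀ z w, DifferentiableAt ℝ (fun y => covAlong g id (fun _ => z) y w) x := fun z w =>
    (hg.contDiffAt_covAlong (u := id) hi hx (hc z) w).differentiableAt (by simp)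
  have hdg : ∀ z t, ContDiffAt ℝ ∞ (fun y => g y z t) x := fun z t =>
    ((hg.contDiffAt x hx).clm_apply contDiffAt_const).clm_apply contDiffAt_const
  have key : ∀ v w, fderiv ℝ (fderiv ℝ (fun y => g y z t)) x v w =
      g x (covAlong g id (fun y => covAlong g id (fun _ => z) y w) x v) t
      + g x (covAlong g id (fun _ => z) x w) (covAlong g id (fun _ => t) x v)
      + (g x (covAlong g id (fun _ => z) x v) (covAlong g id (fun _ => t) x w)
      + g x z (covAlong g id (fun y => covAlong g id (fun _ => t) y w) x v)) := by
    intro v w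
    have h1 : (fun y => fderiv ℝ (fun y => g y z t) y w) =ᶠ[𝓝 x] fun y =>
        g (id y) (covAlong g id (fun _ => z) y w) t + g (id y) z (covAlong g id (fun _ => t) y w) := by
      filter_upwards [hg.isOpen.mem_nhds hx] with y hy
      exact hg.fderiv_inner (u := id) (ξ := fun _ => z) (η := fun _ => t) contDiffAt_id hy
        (differentiableAt_const _) (differentiableAt_const _) w
    have h2 : fderiv ℝ (fun y => fderiv ℝ (fun y => g y z t) y w) x v =
        fderiv ℝ (fderiv ℝ (fun y => g y z t)) x v w := by
      have h3 : DifferentiableAt ℝ (fderiv ℝ (fun y => g y z t)) x :=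
        ((hdg z t).fderiv_right (m := ∞) (by simp)).differentiableAt (by simp)
      have := (h3.hasFDerivAt.clm_apply (hasFDerivAt_const w x)).fderiv
      rw [this]
      simp
    have hgd : DifferentiableAt ℝ (fun y => g (id y)) x :=
      (hg.contDiffAt x hx).differentiableAt (by simp)
    rw [← h2, h1.fderiv_eq, fderiv_fun_add ((hgd.clm_apply (hd z w)).clm_apply
      (differentiableAt_const t)) ((hgd.clm_apply (differentiableAt_const z)).clm_apply (hd t w)),
      add_apply, hg.fderiv_inner hi hx (hd z w) (differentiableAt_const t),
      hg.fderiv_inner hi hx (differentiableAt_const z) (hd t w)]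
    rfl
  have hz := hg.covAlong_comm hi hx (hc z) v w
  have ht := hg.covAlong_comm hi hx (hc t) v w
  have hs := fderiv_fderiv_symm (hdg z t) v w
  simp only [fderiv_id, ContinuousLinearMap.id_apply, id] at hz ht
  rw [← hz, ← ht, hg.symm x hx _ z]
  rw [key, key] at hs
  simp only [map_sub, sub_apply] at hs ⊢
  linear_combination hs

end IsMetricOn

end MetricCalculus

/-! ### Gauss, Weingarten and Ricci equations of an immersion; parallel endomorphism fields. -/

section SubmanifoldEquations

variable {V : Type*} [NormedAddCommGroup V] [NormedSpace ℝ V] [FiniteDimensional ℝ V]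
variable {W : Type*} [NormedAddCommGroup W] [NormedSpace ℝ W] [FiniteDimensional ℝ W]

/-- `u` is a smooth immersion of the open set `U` into `Θ`. -/
structure IsImmersionInto (u : V → W) (U : Set V) (Θ : Set W) : Prop where
  isOpen : IsOpen U
  contDiffAt : ∀ x ∈ U, ContDiffAt ℝ ∞ u x
  mapsTo : ∀ x ∈ U, u x ∈ Θ
  injective : ∀ x ∈ U, Function.Injective (fderiv ℝ u x)

variable {G : W → W →L[ℝ] W →L[ℝ] ℝ} {Θ : Set W} {u ξ η : V → W} {U : Set V} {x : V}

theorem inducedMetric_apply (G : W → W →L[ℝ] W →L[ℝ] ℝ) (u : V → W) (x v w : V) :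
    inducedMetric G u x v w = G (u x) (fderiv ℝ u x v) (fderiv ℝ u x w) := rfl

theorem contDiffAt_bilinearComp {X : Type*} [NormedAddCommGroup X] [NormedSpace ℝ X]
    {B : X → W →L[ℝ] W →L[ℝ] ℝ} {L : X → V →L[ℝ] W} {x : X} (hB : ContDiffAt ℝ ∞ B x)
    (hL : ContDiffAt ℝ ∞ L x) : ContDiffAt ℝ ∞ (fun y => (B y).bilinearComp (L y) (L y)) x := by
  -- `bilinearComp` unfolds to two rounds of composing with `L` and flipping, each of them smooth.
  have h1 : ContDiffAt ℝ ∞ (fun y => ((B y).comp (L y)).flip) x :=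
    (ContinuousLinearMap.flipₗᵢ ℝ V W ℝ).contDiff.contDiffAt.comp x (hB.clm_comp hL)
  exact (ContinuousLinearMap.flipₗᵢ ℝ V V ℝ).contDiff.contDiffAt.comp x (h1.clm_comp hL)

theorem IsMetricOn.inducedMetric (hG : IsMetricOn G Θ) (hu : IsImmersionInto u U Θ) :
    IsMetricOn (inducedMetric G u) U where
  isOpen := hu.isOpen
  contDiffAt x hx := contDiffAt_bilinearComp
    ((hG.contDiffAt _ (hu.mapsTo x hx)).comp x (hu.contDiffAt x hx))
    ((hu.contDiffAt x hx).fderiv_right (by simp))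
  symm x hx v w := hG.symm _ (hu.mapsTo x hx) _ _
  pos x hx v hv := hG.pos _ (hu.mapsTo x hx) _ fun h =>
    hv (hu.injective x hx (h.trans (map_zero _).symm))

theorem tangentialPart_add (G : W → W →L[ℝ] W →L[ℝ] ℝ) (u : V → W) (x : V) (a b : W) :
    tangentialPart G u x (a + b) = tangentialPart G u x a + tangentialPart G u x b := by
  simp [tangentialPart, ContinuousLinearMap.add_comp]

theorem tangentialPart_smul (G : W → W →L[ℝ] W →L[ℝ] ℝ) (u : V → W) (x : V) (r : ℝ) (a : W) :
    tangentialPart G u x (r • a) = r • tangentialPart G u x a := by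
  simp [tangentialPart, ContinuousLinearMap.smul_comp]

/-- `normalPart` as a linear map. -/
def normalPartL (G : W → W →L[ℝ] W →L[ℝ] ℝ) (u : V → W) (x : V) : W →ₗ[ℝ] W where
  toFun := normalPart G u x
  map_add' a b := by
    simp only [normalPart, tangentialPart_add, map_add]
    abel
  map_smul' r a := by
    simp only [normalPart, tangentialPart_smul, map_smul, smul_sub, RingHom.id_apply]

theorem normalPart_add (G : W → W →L[ℝ] W →L[ℝ] ℝ) (u : V → W) (x : V) (a b : W) :
    normalPart G u x (a + b) = normalPart G u x a + normalPart G u x b :=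
  (normalPartL G u x).map_add a b

theorem normalPart_sub (G : W → W →L[ℝ] W →L[ℝ] ℝ) (u : V → W) (x : V) (a b : W) :
    normalPart G u x (a - b) = normalPart G u x a - normalPart G u x b :=
  (normalPartL G u x).map_sub a b

theorem normalPart_smul (G : W → W →L[ℝ] W →L[ℝ] ℝ) (u : V → W) (x : V) (r : ℝ) (a : W) :
    normalPart G u x (r • a) = r • normalPart G u x a :=
  (normalPartL G u x).map_smul r a

theorem normalPart_add_tangentialPart (G : W → W →L[ℝ] W →L[ℝ] ℝ) (u : V → W) (x : V) (a : W) :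
    a = fderiv ℝ u x (tangentialPart G u x a) + normalPart G u x a := by
  simp [normalPart]

theorem normalCov_eq (G : W → W →L[ℝ] W →L[ℝ] ℝ) (u ξ : V → W) (x v : V) :
    normalCov G u ξ x v = covAlong G u ξ x v
      - fderiv ℝ u x (tangentialPart G u x (covAlong G u ξ x v)) := rfl

namespace IsMetricOn

theorem inner_tangentialPart (hG : IsMetricOn G Θ) (hu : IsImmersionInto u U Θ) (hx : x ∈ U)
    (a : W) (s : V) :
    G (u x) (fderiv ℝ u x (tangentialPart G u x a)) (fderiv ℝ u x s) =
      G (u x) a (fderiv ℝ u x s) := by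
  rw [← inducedMetric_apply, tangentialPart,
    ((hG.inducedMetric hu).isInvertible hx).self_apply_inverse]
  rfl

theorem tangentialPart_eq (hG : IsMetricOn G Θ) (hu : IsImmersionInto u U Θ) (hx : x ∈ U)
    {a : W} {v : V}
    (h : ∀ s, G (u x) (fderiv ℝ u x v) (fderiv ℝ u x s) = G (u x) a (fderiv ℝ u x s)) :
    tangentialPart G u x a = v :=
  (hG.inducedMetric hu).eq_of_apply_eq hx fun s => by
    rw [inducedMetric_apply, inducedMetric_apply, hG.inner_tangentialPart hu hx, h]

theorem tangentialPart_fderiv (hG : IsMetricOn G Θ) (hu : IsImmersionInto u U Θ) (hx : x ∈ U)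
    (v : V) : tangentialPart G u x (fderiv ℝ u x v) = v :=
  hG.tangentialPart_eq hu hx fun _ => rfl

theorem inner_normalPart (hG : IsMetricOn G Θ) (hu : IsImmersionInto u U Θ) (hx : x ∈ U)
    (a : W) (s : V) :
    G (u x) (normalPart G u x a) (fderiv ℝ u x s) = 0 := by
  simp [normalPart, hG.inner_tangentialPart hu hx]

theorem normalPart_fderiv (hG : IsMetricOn G Θ) (hu : IsImmersionInto u U Θ) (hx : x ∈ U)
    (v : V) : normalPart G u x (fderiv ℝ u x v) = 0 := by
  simp [normalPart, hG.tangentialPart_fderiv hu hx]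

theorem normalPart_of_normal (hG : IsMetricOn G Θ) (hu : IsImmersionInto u U Θ) (hx : x ∈ U)
    {a : W} (h : ∀ s, G (u x) a (fderiv ℝ u x s) = 0) :
    normalPart G u x a = a := by
  rw [normalPart, hG.tangentialPart_eq hu hx (v := 0) (by simp [h])]
  simp

theorem inner_normalPart_of_normal (hG : IsMetricOn G Θ) (hu : IsImmersionInto u U Θ) (hx : x ∈ U)
    {a b : W} (h : ∀ s, G (u x) b (fderiv ℝ u x s) = 0) :
    G (u x) (normalPart G u x a) b = G (u x) a b := by
  rw [normalPart, map_sub, sub_apply, hG.symm _ (hu.mapsTo x hx) (fderiv ℝ u x _) b, h, sub_zero]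

theorem contDiffAt_tangentialPart (hG : IsMetricOn G Θ) (hu : IsImmersionInto u U Θ) (hx : x ∈ U)
    (hξ : ContDiffAt ℝ ∞ ξ x) :
    ContDiffAt ℝ ∞ (fun y => tangentialPart G u y (ξ y)) x := by
  have h1 := (hG.inducedMetric hu).contDiffAt_inverse hx
  have h2 : ContDiffAt ℝ ∞ (fun y => G (u y)) x :=
    (hG.contDiffAt _ (hu.mapsTo x hx)).comp x (hu.contDiffAt x hx)
  have h3 : ContDiffAt ℝ ∞ (fderiv ℝ u) x := (hu.contDiffAt x hx).fderiv_right (by simp)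
  exact h1.clm_apply ((h2.clm_apply hξ).clm_comp h3)

theorem contDiffAt_normalPart (hG : IsMetricOn G Θ) (hu : IsImmersionInto u U Θ) (hx : x ∈ U)
    (hξ : ContDiffAt ℝ ∞ ξ x) :
    ContDiffAt ℝ ∞ (fun y => normalPart G u y (ξ y)) x := by
  have h3 : ContDiffAt ℝ ∞ (fderiv ℝ u) x := (hu.contDiffAt x hx).fderiv_right (by simp)
  exact hξ.sub (h3.clm_apply (hG.contDiffAt_tangentialPart hu hx hξ))

theorem isNormalFieldAt_normalPart (hG : IsMetricOn G Θ) (hu : IsImmersionInto u U Θ) (hx : x ∈ U)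
    (hξ : ContDiffAt ℝ ∞ ξ x) :
    IsNormalFieldAt G u (fun y => normalPart G u y (ξ y)) x := by
  refine ⟨hG.contDiffAt_normalPart hu hx hξ, ?_⟩
  filter_upwards [hu.isOpen.mem_nhds hx] with y hy v using hG.inner_normalPart hu hy _ _

theorem isNormalFieldAt_sff (hG : IsMetricOn G Θ) (hu : IsImmersionInto u U Θ) (hx : x ∈ U)
    (z t : V) : IsNormalFieldAt G u (fun y => sff G u y z t) x :=
  hG.isNormalFieldAt_normalPart hu hx (hG.contDiffAt_covAlong (hu.contDiffAt x hx)
    (hu.mapsTo x hx) (contDiffAt_fderiv_apply (hu.contDiffAt x hx) t) z)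

/-- The pushforward along `u` has no torsion. -/
theorem covAlong_fderiv_symm (hG : IsMetricOn G Θ) (hu : IsImmersionInto u U Θ) (hx : x ∈ U)
    (v w : V) :
    covAlong G u (fun y => fderiv ℝ u y w) x v = covAlong G u (fun y => fderiv ℝ u y v) x w := by
  have hu2 : DifferentiableAt ℝ (fderiv ℝ u) x :=
    ((hu.contDiffAt x hx).fderiv_right (m := ∞) (by simp)).differentiableAt (by simp)
  have h : ∀ w, fderiv ℝ (fun y => fderiv ℝ u y w) x = (fderiv ℝ (fderiv ℝ u) x).flip w := by
    intro w
    have := (hu2.hasFDerivAt.clm_apply (hasFDerivAt_const w x)).fderiv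
    rw [this]
    ext
    simp
  simp only [covAlong, christoffel_eq, h, ContinuousLinearMap.flip_apply]
  rw [fderiv_fderiv_symm (hu.contDiffAt x hx), hG.connForm_symm (hu.mapsTo x hx)]

theorem sff_symm (hG : IsMetricOn G Θ) (hu : IsImmersionInto u U Θ) (hx : x ∈ U)
    (v w : V) : sff G u x v w = sff G u x w v := by
  rw [sff, hG.covAlong_fderiv_symm hu hx, sff]

/-- The tangential part of the ambient connection is the Levi-Civita connection of the induced
metric. -/
theorem tangentialPart_covAlong_fderiv (hG : IsMetricOn G Θ) (hu : IsImmersionInto u U Θ) (hx : x ∈ U)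
    (v w : V) :
    tangentialPart G u x (covAlong G u (fun y => fderiv ℝ u y w) x v) =
      connForm (TotReal.inducedMetric G u) x v w := by
  have hh := hG.inducedMetric hu
  have hd : ∀ w, DifferentiableAt ℝ (fun y => fderiv ℝ u y w) x := fun w =>
    (contDiffAt_fderiv_apply (hu.contDiffAt x hx) w).differentiableAt (by simp)
  have key : ∀ a b c, fderiv ℝ (TotReal.inducedMetric G u) x a b c =
      G (u x) (covAlong G u (fun y => fderiv ℝ u y b) x a) (fderiv ℝ u x c)
      + G (u x) (covAlong G u (fun y => fderiv ℝ u y c) x a) (fderiv ℝ u x b) := by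
    intro a b c
    have h1 := hG.fderiv_inner (hu.contDiffAt x hx) (hu.mapsTo x hx) (hd b) (hd c) a
    rw [hG.symm _ (hu.mapsTo x hx) (fderiv ℝ u x b)] at h1
    rw [← h1]
    have hhd : DifferentiableAt ℝ (TotReal.inducedMetric G u) x :=
      (hh.contDiffAt x hx).differentiableAt (by simp)
    have h2 := ((hhd.hasFDerivAt.clm_apply (hasFDerivAt_const b x)).clm_apply
      (hasFDerivAt_const c x)).fderiv
    change _ = fderiv ℝ (fun y => TotReal.inducedMetric G u y b c) x a
    rw [h2]
    simp
  refine hG.tangentialPart_eq hu hx fun s => ?_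
  rw [← inducedMetric_apply, hh.apply_connForm hx, key, key, key,
    hG.covAlong_fderiv_symm hu hx w v, hG.covAlong_fderiv_symm hu hx w s,
    hG.covAlong_fderiv_symm hu hx s v]
  ring

theorem covAlong_fderiv_const (hG : IsMetricOn G Θ) (hu : IsImmersionInto u U Θ) (hx : x ∈ U)
    (v w : V) :
    covAlong G u (fun y => fderiv ℝ u y w) x v =
      fderiv ℝ u x (connForm (TotReal.inducedMetric G u) x v w) + sff G u x v w := by
  rw [← hG.tangentialPart_covAlong_fderiv hu hx]
  exact normalPart_add_tangentialPart _ _ _ _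

/-- Gauss formula. -/
theorem covAlong_fderiv (hG : IsMetricOn G Θ) (hu : IsImmersionInto u U Θ) (hx : x ∈ U)
    {Y : V → V} (hY : DifferentiableAt ℝ Y x) (v : V) :
    covAlong G u (fun y => fderiv ℝ u y (Y y)) x v =
      fderiv ℝ u x (cov (TotReal.inducedMetric G u) Y x v) + sff G u x v (Y x) := by
  have hu2 : DifferentiableAt ℝ (fderiv ℝ u) x :=
    ((hu.contDiffAt x hx).fderiv_right (m := ∞) (by simp)).differentiableAt (by simp)
  have h1 : covAlong G u (fun y => fderiv ℝ u y (Y y)) x v =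
      fderiv ℝ u x (fderiv ℝ Y x v) + covAlong G u (fun y => fderiv ℝ u y (Y x)) x v := by
    have e1 := (hu2.hasFDerivAt.clm_apply hY.hasFDerivAt).fderiv
    have e2 := (hu2.hasFDerivAt.clm_apply (hasFDerivAt_const (Y x) x)).fderiv
    simp only [covAlong, e1, e2]
    simp
    abel
  rw [h1, hG.covAlong_fderiv_const hu hx, cov, christoffel_eq, map_add]
  abel

/-- The right side depends on `Y` only through its value at `x`. This evaluates derivatives of
tangential parts in the Ricci equation and in `exists_shape` without knowing those parts near `x`.
-/
theorem normalCov_fderiv (hG : IsMetricOn G Θ) (hu : IsImmersionInto u U Θ) (hx : x ∈ U)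
    {Y : V → V} (hY : DifferentiableAt ℝ Y x) (v : V) :
    normalCov G u (fun y => fderiv ℝ u y (Y y)) x v = sff G u x v (Y x) := by
  rw [normalCov, hG.covAlong_fderiv hu hx hY, normalPart_add, hG.normalPart_fderiv hu hx, zero_add]
  exact hG.normalPart_of_normal hu hx fun s => hG.inner_normalPart hu hx _ _

theorem inner_sff (hG : IsMetricOn G Θ) (hu : IsImmersionInto u U Θ) (hx : x ∈ U)
    (v w s : V) : G (u x) (sff G u x v w) (fderiv ℝ u x s) = 0 :=
  hG.inner_normalPart hu hx _ _

/-- Weingarten formula. -/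
theorem inner_covAlong_normal (hG : IsMetricOn G Θ) (hu : IsImmersionInto u U Θ) (hx : x ∈ U)
    (hξ : IsNormalFieldAt G u ξ x) (v s : V) :
    G (u x) (covAlong G u ξ x v) (fderiv ℝ u x s) = - G (u x) (ξ x) (sff G u x v s) := by
  have hd : DifferentiableAt ℝ (fun y => fderiv ℝ u y s) x :=
    (contDiffAt_fderiv_apply (hu.contDiffAt x hx) s).differentiableAt (by simp)
  have h1 := hG.fderiv_inner (hu.contDiffAt x hx) (hu.mapsTo x hx)
    (hξ.1.differentiableAt (by simp)) hd v
  have h2 : (fun y => G (u y) (ξ y) (fderiv ℝ u y s)) =ᶠ[𝓝 x] fun _ => 0 := by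
    filter_upwards [hξ.2] with y hy using hy s
  rw [h2.fderiv_eq, hG.covAlong_fderiv_const hu hx, map_add, hξ.2.self_of_nhds] at h1
  simp at h1
  linarith

/-- Gauss equation. -/
theorem gauss (hG : IsMetricOn G Θ) (hu : IsImmersionInto u U Θ) (hx : x ∈ U)
    (v w z t : V) :
    G (u x) (curv G (u x) (fderiv ℝ u x v) (fderiv ℝ u x w) (fderiv ℝ u x z)) (fderiv ℝ u x t) =
      TotReal.inducedMetric G u x (curv (TotReal.inducedMetric G u) x v w z) t
      - G (u x) (sff G u x w z) (sff G u x v t) + G (u x) (sff G u x v z) (sff G u x w t) := by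
  have hh := hG.inducedMetric hu
  rw [← hG.covAlong_comm (hu.contDiffAt x hx) (hu.mapsTo x hx)
    (contDiffAt_fderiv_apply (hu.contDiffAt x hx) z)]
  have key : ∀ v w, G (u x) (covAlong G u (fun y => covAlong G u (fun y => fderiv ℝ u y z) y w) x v)
      (fderiv ℝ u x t) = TotReal.inducedMetric G u x (cov (TotReal.inducedMetric G u)
        (fun y => cov (TotReal.inducedMetric G u) (fun _ => z) y w) x v) t
        - G (u x) (sff G u x w z) (sff G u x v t) := by
    intro v w
    have hY : ContDiffAt ℝ ∞ (fun y => cov (TotReal.inducedMetric G u) (fun _ => z) y w) x := by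
      simp only [cov_const]
      exact ((hh.contDiffAt_connForm hx).clm_apply contDiffAt_const).clm_apply contDiffAt_const
    have h1 : (fun y => covAlong G u (fun y => fderiv ℝ u y z) y w) =ᶠ[𝓝 x] fun y =>
        fderiv ℝ u y (cov (TotReal.inducedMetric G u) (fun _ => z) y w) + sff G u y w z := by
      filter_upwards [hu.isOpen.mem_nhds hx] with y hy
      rw [hG.covAlong_fderiv_const hu hy, cov_const]
    have hu3 : ContDiffAt ℝ ∞ (fderiv ℝ u) x := (hu.contDiffAt x hx).fderiv_right (by simp)
    have hσ := hG.isNormalFieldAt_sff hu hx w z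
    rw [covAlong_congr h1, covAlong_add ((hu3.clm_apply hY).differentiableAt (by simp))
      (hσ.1.differentiableAt (by simp)), hG.covAlong_fderiv hu hx (hY.differentiableAt (by simp)),
      map_add, map_add, add_apply, add_apply, hG.inner_sff hu hx,
      hG.inner_covAlong_normal hu hx hσ, ← inducedMetric_apply]
    ring
  rw [map_sub, sub_apply, key, key, curv, map_sub, sub_apply]
  ring

/-- Ricci equation. -/
theorem normalCurv_eq (hG : IsMetricOn G Θ) (hu : IsImmersionInto u U Θ) (hx : x ∈ U)
    (hξ : IsNormalFieldAt G u ξ x) (v w : V) :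
    normalCurv G u ξ x v w =
      normalPart G u x (curv G (u x) (fderiv ℝ u x v) (fderiv ℝ u x w) (ξ x))
      - sff G u x v (tangentialPart G u x (covAlong G u ξ x w))
      + sff G u x w (tangentialPart G u x (covAlong G u ξ x v)) := by
  have key : ∀ v w, normalCov G u (fun y => normalCov G u ξ y w) x v =
      normalPart G u x (covAlong G u (fun y => covAlong G u ξ y w) x v)
      - sff G u x v (tangentialPart G u x (covAlong G u ξ x w)) := by
    intro v w
    have h1 := hG.contDiffAt_covAlong (hu.contDiffAt x hx) (hu.mapsTo x hx) hξ.1 w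
    have h2 := hG.contDiffAt_tangentialPart hu hx h1
    have hu3 : ContDiffAt ℝ ∞ (fderiv ℝ u) x := (hu.contDiffAt x hx).fderiv_right (by simp)
    rw [← hG.normalCov_fderiv hu hx (h2.differentiableAt (by simp))]
    simp only [normalCov_eq G u ξ]
    rw [normalCov, covAlong_sub (h1.differentiableAt (by simp))
      ((hu3.clm_apply h2).differentiableAt (by simp)), normalPart_sub]
    rfl
  rw [normalCurv, key, key, ← hG.covAlong_comm (hu.contDiffAt x hx) (hu.mapsTo x hx) hξ.1,
    normalPart_sub]
  abel

/-- A form in which bilinearity is visible. -/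
theorem sff_eq (G : W → W →L[ℝ] W →L[ℝ] ℝ) {u : V → W} {x : V} (hu : ContDiffAt ℝ ∞ u x)
    (v w : V) : sff G u x v w = normalPart G u x (fderiv ℝ (fderiv ℝ u) x v w
      + connForm G (u x) (fderiv ℝ u x v) (fderiv ℝ u x w)) := by
  have hu2 : DifferentiableAt ℝ (fderiv ℝ u) x :=
    (hu.fderiv_right (m := ∞) (by simp)).differentiableAt (by simp)
  have := (hu2.hasFDerivAt.clm_apply (hasFDerivAt_const w x)).fderiv
  rw [sff, covAlong, this, christoffel_eq]
  simp

/-- The second fundamental form as a bilinear map. -/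
def sffL (G : W → W →L[ℝ] W →L[ℝ] ℝ) (u : V → W) (x : V) (hu : ContDiffAt ℝ ∞ u x) :
    V →ₗ[ℝ] V →ₗ[ℝ] W :=
  LinearMap.mk₂ ℝ (sff G u x)
    (fun a b c => by
      simp only [sff_eq G hu, map_add, add_apply, ← normalPart_add]
      congr 1
      abel)
    (fun r a c => by simp only [sff_eq G hu, map_smul, smul_apply, ← smul_add, normalPart_smul])
    (fun a b c => by
      simp only [sff_eq G hu, map_add, ← normalPart_add]
      congr 1
      abel)
    (fun r a c => by simp only [sff_eq G hu, map_smul, ← smul_add, normalPart_smul])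

section Kahler

variable {J : W → W →L[ℝ] W}

/-- A parallel endomorphism field commutes with the connection along a map. -/
theorem covAlong_parallel {y : W} {u ξ : V → W} {x : V} (hy : u x = y)
    (hJ : DifferentiableAt ℝ J y) (hu : DifferentiableAt ℝ u x) (hξ : DifferentiableAt ℝ ξ x)
    (hpar : ∀ v w, cov G (fun y' => J y' w) y v = J y (cov G (fun _ => w) y v)) (v : V) :
    covAlong G u (fun y => J (u y) (ξ y)) x v = J (u x) (covAlong G u ξ x v) := by
  subst hy
  have h1 := ((hJ.hasFDerivAt.comp x hu.hasFDerivAt).clm_apply hξ.hasFDerivAt).fderiv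
  have h2 : ∀ v w, cov G (fun y' => J y' w) (u x) v =
      fderiv ℝ J (u x) v w + connForm G (u x) v (J (u x) w) := by
    intro v w
    have := (hJ.hasFDerivAt.clm_apply (hasFDerivAt_const w (u x))).fderiv
    rw [cov, this, christoffel_eq]
    simp
  have h3 := hpar (fderiv ℝ u x v) (ξ x)
  rw [h2, cov_const] at h3
  simp only [Function.comp_apply] at h1
  rw [covAlong, h1, covAlong, christoffel_eq, christoffel_eq, map_add, ← h3]
  simp
  abel

/-- The curvature is the commutator of second covariant derivatives, and a parallel `J` passes
through each derivative of the field `J z`. -/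
theorem curv_parallel {g : W → W →L[ℝ] W →L[ℝ] ℝ} {Ω : Set W} {y : W} (hg : IsMetricOn g Ω)
    (hy : y ∈ Ω) (hJ : ∀ y ∈ Ω, ContDiffAt ℝ ∞ J y)
    (hpar : ∀ y ∈ Ω, ∀ v w, cov g (fun y' => J y' w) y v = J y (cov g (fun _ => w) y v))
    (v w z : W) : curv g y v w (J y z) = J y (curv g y v w z) := by
  have hi : ContDiffAt ℝ ∞ (id : W → W) y := contDiffAt_id
  have hc : ContDiffAt ℝ ∞ (fun _ : W => z) y := contDiffAt_const
  have hJd : ∀ y ∈ Ω, DifferentiableAt ℝ J y := fun y hy => (hJ y hy).differentiableAt (by simp)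
  have h1 := hg.covAlong_comm hi hy (ξ := fun y => J (id y) z) ((hJ y hy).clm_apply hc) v w
  have h2 := hg.covAlong_comm hi hy hc v w
  have key : ∀ v w, covAlong g id (fun y => covAlong g id (fun y => J (id y) z) y w) y v =
      J y (covAlong g id (fun y => covAlong g id (fun _ => z) y w) y v) := by
    intro v w
    have h3 : (fun y => covAlong g id (fun y => J (id y) z) y w) =ᶠ[𝓝 y] fun y =>
        J (id y) (covAlong g id (fun _ => z) y w) := by
      filter_upwards [hg.isOpen.mem_nhds hy] with y hy
      exact covAlong_parallel (u := id) (ξ := fun _ => z) rfl (hJd y hy) differentiableAt_id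
        (differentiableAt_const z) (hpar y hy) w
    rw [covAlong_congr h3]
    exact covAlong_parallel (u := id) rfl (hJd y hy) differentiableAt_id
      ((hg.contDiffAt_covAlong hi hy hc w).differentiableAt (by simp)) (hpar y hy) v
  rw [key, key, ← map_sub, h2] at h1
  simpa [fderiv_id] using h1.symm

end Kahler

end IsMetricOn

end SubmanifoldEquations

/-! ### Algebraic curvature tensors and their sectional and holomorphic curvatures. -/

section CurvatureForms

variable {W : Type*} [AddCommGroup W]

/-- The algebraic symmetries of a curvature tensor. -/
structure IsCurvatureForm (R : W → W → W → W → ℝ) : Prop where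
  add_left : ∀ a a' b c d, R (a + a') b c d = R a b c d + R a' b c d
  antisymm_left : ∀ a b c d, R a b c d = -R b a c d
  antisymm_right : ∀ a b c d, R a b c d = -R a b d c
  bianchi : ∀ a b c d, R a b c d + R b c a d + R c a b d = 0

namespace IsCurvatureForm

variable {R : W → W → W → W → ℝ}

/-- The octahedron argument: four Bianchi identities, one for each cyclic rotation of `a, b, c, d`,
combined through the two antisymmetries. -/
theorem pair_symm (h : IsCurvatureForm R) (a b c d : W) : R a b c d = R c d a b := by
  have h1 := h.bianchi a b c d
  have h2 := h.bianchi b c d a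
  have h3 := h.bianchi c d a b
  have h4 := h.bianchi d a b c
  linarith [h.antisymm_right b c a d, h.antisymm_right c a b d, h.antisymm_left c a b d,
    h.antisymm_left c a d b, h.antisymm_right c d b a, h.antisymm_right d b c a,
    h.antisymm_left d b a c, h.antisymm_right d a c b, h.antisymm_right a b d c,
    h.antisymm_left b d c a, h.antisymm_right a c b d, h.antisymm_right b d a c,
    h.antisymm_left b d a c, h.antisymm_right d a b c, h.antisymm_left a c d b]

theorem add_two (h : IsCurvatureForm R) (a b b' c d : W) :
    R a (b + b') c d = R a b c d + R a b' c d := by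
  rw [h.antisymm_left, h.add_left, h.antisymm_left b, h.antisymm_left b']
  ring

theorem add_three (h : IsCurvatureForm R) (a b c c' d : W) :
    R a b (c + c') d = R a b c d + R a b c' d := by
  rw [h.pair_symm, h.add_left, h.pair_symm c, h.pair_symm c']

theorem add_four (h : IsCurvatureForm R) (a b c d d' : W) :
    R a b c (d + d') = R a b c d + R a b c d' := by
  rw [h.pair_symm, h.add_two, h.pair_symm c, h.pair_symm c]

theorem neg_left (h : IsCurvatureForm R) (a b c d : W) : R (-a) b c d = -R a b c d := by
  have h0 := h.add_left 0 0 b c d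
  have h1 := h.add_left a (-a) b c d
  simp only [add_zero, add_neg_cancel] at h0 h1
  linarith

theorem neg_two (h : IsCurvatureForm R) (a b c d : W) : R a (-b) c d = -R a b c d := by
  rw [h.antisymm_left, h.neg_left, h.antisymm_left b, neg_neg]

theorem neg_three (h : IsCurvatureForm R) (a b c d : W) : R a b (-c) d = -R a b c d := by
  rw [h.pair_symm, h.neg_left, h.pair_symm c]

theorem neg_four (h : IsCurvatureForm R) (a b c d : W) : R a b c (-d) = -R a b c d := by
  rw [h.pair_symm, h.neg_two, h.pair_symm c]

/-- A curvature form is determined by its sectional curvatures. -/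
theorem eq_zero_of_sectional (h : IsCurvatureForm R) (h0 : ∀ a b, R a b b a = 0) (a b c d : W) :
    R a b c d = 0 := by
  -- Polarization: first in the outer pair of arguments, then in the inner pair. The resulting
  -- antisymmetry in the middle slots contradicts Bianchi unless `R = 0`.
  have h1 : ∀ a b d, R a b b d = 0 := by
    intro a b d
    have e := h0 (a + d) b
    rw [h.add_left, h.add_four, h.add_four, h0, h0, h.pair_symm d, h.antisymm_left b a,
      h.antisymm_right a b d b] at e
    linarith
  have h2 : ∀ a b c d, R a b c d = -R a c b d := by
    intro a b c d
    have e := h1 a (b + c) d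
    rw [h.add_two, h.add_three, h.add_three, h1, h1] at e
    linarith
  have e := h.bianchi a b c d
  rw [h2 b c a d, h.antisymm_left b a, h.antisymm_left c a b d, h2 a c b d] at e
  linarith

/-- A Kähler curvature form is determined by its holomorphic sectional curvatures. -/
theorem eq_zero_of_holomorphic (h : IsCurvatureForm R) {J : W → W}
    (hadd : ∀ a b, J (a + b) = J a + J b) (hneg : ∀ a, J (-a) = -J a) (hJ : ∀ a, J (J a) = -a)
    (hR : ∀ a b c d, R a b (J c) (J d) = R a b c d) (h0 : ∀ a, R a (J a) (J a) a = 0)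
    (a b c d : W) : R a b c d = 0 := by
  have hR' : ∀ a b c d, R (J a) (J b) c d = R a b c d := fun a b c d => by
    rw [h.pair_symm, hR, h.pair_symm]
  refine h.eq_zero_of_sectional ?_ a b c d
  -- Polarizing the holomorphic curvature at `a + b` and `a - b` isolates the terms of degree two in
  -- each of `a, b`; `J`-invariance and Bianchi reduce them to this relation. Replacing `b` by `J b`
  -- gives a second relation, and the two together force `R a b b a = 0`.
  have key : ∀ a b, R a b b a + 3 * R a (J b) (J b) a = 0 := by
    intro a b
    have e1 := h0 (a + b)
    have e2 := h0 (a + -b)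
    simp only [hadd, hneg, h.add_left, h.add_two, h.add_three, h.add_four, h.neg_left, h.neg_two,
      h.neg_three, h.neg_four, h0] at e1 e2
    have f1 : R b (J b) (J a) a = R a (J a) (J b) b := by
      rw [h.pair_symm, h.antisymm_left, h.antisymm_right, neg_neg]
    have f2 : R b (J a) (J a) b = R a (J b) (J b) a := by
      rw [← hR', ← hR, hJ, h.neg_two, h.neg_three, neg_neg, h.antisymm_left, h.antisymm_right,
        neg_neg]
    have f3 : R b (J a) (J b) a = R a (J b) (J a) b := by
      rw [h.pair_symm, h.antisymm_left, h.antisymm_right, neg_neg]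
    have f4 : R a (J b) (J a) b = R a (J b) (J b) a := by
      rw [← hR, hJ, h.neg_three, h.antisymm_right, neg_neg]
    have f5 := h.bianchi a (J a) (J b) b
    rw [hR', h.antisymm_right a b a b, h.antisymm_left (J b) a, f4] at f5
    linarith
  intro a b
  have e1 := key a b
  have e2 := key a (J b)
  rw [hJ, h.neg_two, h.neg_three] at e2
  linarith

end IsCurvatureForm

end CurvatureForms

/-! ### Trace-free cubic forms: Simons identity and the resulting estimates. -/

section SymmetricTensors

variable {ι : Type*} [Fintype ι] [DecidableEq ι]

/-- The curvature tensor of constant sectional curvature one in an orthonormal basis. -/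
def unitCurv (i j k l : ι) : ℝ :=
  (if j = k then 1 else 0) * (if i = l then 1 else 0)
    - (if i = k then 1 else 0) * (if j = l then 1 else 0)

/-- The commutator term `⟨[A_i, A_j] e_k, e_l⟩` of the cubic form `C`. -/
def cubicCurv (C : ι → ι → ι → ℝ) (i j k l : ι) : ℝ :=
  ∑ m, (C j k m * C i l m - C i k m * C j l m)

/-- The squared norm of the cubic form `C`. -/
def cubicNormSq (C : ι → ι → ι → ℝ) : ℝ := ∑ i, ∑ j, ∑ k, C i j k ^ 2

/-- The quadratic form `tr (A_i A_j)` of the cubic form `C`. -/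
def cubicGram (C : ι → ι → ι → ℝ) (i j : ι) : ℝ := ∑ k, ∑ l, C i k l * C j k l

theorem sum_unitCurv_mul (X : ι → ι → ι → ι → ℝ) :
    ∑ i, ∑ j, ∑ k, ∑ l, unitCurv i j k l * X i j k l = ∑ i, ∑ j, (X i j j i - X i j i j) := by
  refine Finset.sum_congr rfl fun i _ => Finset.sum_congr rfl fun j _ => ?_
  simp only [unitCurv, sub_mul, Finset.sum_sub_distrib, mul_assoc, ← Finset.mul_sum]
  simp

theorem sum_rotate {α : Type*} [AddCommMonoid α] (f : ι → ι → ι → α) :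
    ∑ t, ∑ s, ∑ m, f t s m = ∑ m, ∑ t, ∑ s, f t s m := by
  rw [Finset.sum_comm (f := fun m t => ∑ s, f t s m)]
  exact Finset.sum_congr rfl fun t _ => Finset.sum_comm

theorem sum_sq_nonneg (X : ι → ι → ι → ι → ℝ) : 0 ≤ ∑ i, ∑ j, ∑ k, ∑ l, X i j k l ^ 2 :=
  Finset.sum_nonneg fun _ _ => Finset.sum_nonneg fun _ _ => Finset.sum_nonneg fun _ _ =>
    Finset.sum_nonneg fun _ _ => sq_nonneg _

theorem eq_zero_of_sum_sq_eq_zero (X : ι → ι → ι → ι → ℝ)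
    (h : ∑ i, ∑ j, ∑ k, ∑ l, X i j k l ^ 2 = 0) (i j k l : ι) : X i j k l = 0 := by
  have h0 : ∀ f : ι → ℝ, (∀ i, 0 ≤ f i) → ∑ i, f i = 0 → ∀ i, f i = 0 := fun f hf hs i =>
    (Finset.sum_eq_zero_iff_of_nonneg (fun i _ => hf i)).1 hs i (Finset.mem_univ i)
  have n1 : ∀ i j k, 0 ≤ ∑ l, X i j k l ^ 2 := fun i j k => Finset.sum_nonneg fun _ _ => sq_nonneg _
  have n2 : ∀ i j, 0 ≤ ∑ k, ∑ l, X i j k l ^ 2 := fun i j => Finset.sum_nonneg fun _ _ => n1 _ _ _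
  have n3 : ∀ i, 0 ≤ ∑ j, ∑ k, ∑ l, X i j k l ^ 2 := fun i => Finset.sum_nonneg fun _ _ => n2 _ _
  exact pow_eq_zero_iff (two_ne_zero) |>.1
    (h0 _ (fun _ => sq_nonneg _) (h0 _ (n1 i j) (h0 _ (n2 i) (h0 _ n3 h i) j) k) l)

/-- `C` is a totally symmetric trace-free cubic form. -/
structure IsHarmonicCubic (C : ι → ι → ι → ℝ) : Prop where
  symm₁₂ : ∀ i j k, C i j k = C j i k
  symm₂₃ : ∀ i j k, C i j k = C i k j
  trace : ∀ k, ∑ i, C i i k = 0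

/-- The Gauss curvature `c • unitCurv + cubicCurv`. -/
def gaussCurv (c : ℝ) (C : ι → ι → ι → ℝ) (i j k l : ι) : ℝ :=
  c * unitCurv i j k l + cubicCurv C i j k l

theorem gaussCurv_antisymm_left (c : ℝ) (C : ι → ι → ι → ℝ) (i j k l : ι) :
    gaussCurv c C i j k l = -gaussCurv c C j i k l := by
  have : cubicCurv C i j k l = -cubicCurv C j i k l := by
    simp [cubicCurv]
  rw [gaussCurv, gaussCurv, this, unitCurv, unitCurv]
  ring

theorem gaussCurv_antisymm_right (c : ℝ) (C : ι → ι → ι → ℝ) (i j k l : ι) :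
    gaussCurv c C i j k l = -gaussCurv c C i j l k := by
  have : cubicCurv C i j k l = -cubicCurv C i j l k := by
    simp only [cubicCurv, ← Finset.sum_neg_distrib]
    exact Finset.sum_congr rfl fun m _ => by ring
  rw [gaussCurv, gaussCurv, this, unitCurv, unitCurv]
  ring

/-- The algebraic semiparallelity condition for the cubic form `C`. -/
def IsSemiparallelCubic (c : ℝ) (C : ι → ι → ι → ℝ) : Prop :=
  ∀ v w z t s, ∑ m, (C z t m * gaussCurv c C v w m s - C m t s * gaussCurv c C v w z m
    - C z m s * gaussCurv c C v w t m) = 0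

namespace IsHarmonicCubic

variable {C : ι → ι → ι → ℝ}

theorem sum_trace_mul (h : IsHarmonicCubic C) (X : ι → ι → ℝ) :
    ∑ i, ∑ j, ∑ m, C i i m * X j m = 0 := by
  rw [Finset.sum_comm]
  refine Finset.sum_eq_zero fun j _ => ?_
  rw [Finset.sum_comm]
  refine Finset.sum_eq_zero fun m _ => ?_
  rw [← Finset.sum_mul, h.trace, zero_mul]

/-- The product of traces vanishes since `C` is trace-free; the other term is minus a sum of squares
by total symmetry. -/
theorem sum_cubicCurv_trace (h : IsHarmonicCubic C) :
    ∑ i, ∑ j, cubicCurv C i j j i = - cubicNormSq C := by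
  have h1 := h.sum_trace_mul (fun j m => C j j m)
  have : ∀ i j m, C j j m * C i i m - C i j m * C j i m = C i i m * C j j m - C i j m ^ 2 := by
    intro i j m
    rw [h.symm₁₂ j i m]
    ring
  simp only [cubicCurv, this, Finset.sum_sub_distrib, h1, cubicNormSq]
  ring

theorem sum_unitCurv_mul_cubicCurv (h : IsHarmonicCubic C) :
    ∑ i, ∑ j, ∑ k, ∑ l, unitCurv i j k l * cubicCurv C i j k l = -2 * cubicNormSq C := by
  rw [sum_unitCurv_mul]
  have : ∀ i j, cubicCurv C i j j i - cubicCurv C i j i j = 2 * cubicCurv C i j j i := by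
    intro i j
    simp only [cubicCurv, ← Finset.sum_sub_distrib, Finset.mul_sum]
    exact Finset.sum_congr rfl fun m _ => by ring
  simp only [this, ← Finset.mul_sum, h.sum_cubicCurv_trace]
  ring

theorem sum_unitCurv_sq :
    ∑ i : ι, ∑ j : ι, ∑ k : ι, ∑ l : ι, unitCurv i j k l * unitCurv i j k l
      = 2 * ((Fintype.card ι : ℝ) * (Fintype.card ι - 1)) := by
  rw [sum_unitCurv_mul]
  have : ∀ i j : ι, unitCurv i j j i - unitCurv i j i j = 2 * (1 - if i = j then 1 else 0) := by
    intro i j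
    by_cases h : i = j
    · simp [unitCurv, h]
    · simp [unitCurv, h, Ne.symm h]
      norm_num
  simp only [this, ← Finset.mul_sum, Finset.sum_sub_distrib]
  simp
  ring

theorem sum_cubicGram (C : ι → ι → ι → ℝ) : ∑ i, cubicGram C i i = cubicNormSq C := by
  simp only [cubicGram, cubicNormSq, sq]

theorem cubicGram_sum_unit (C : ι → ι → ι → ℝ) :
    ∑ i, ∑ j, cubicGram C i j * (if i = j then 1 else 0) = cubicNormSq C := by
  simp [sum_cubicGram]

theorem sum_gaussCurv_mul_cubicCurv (h : IsHarmonicCubic C) (c : ℝ) :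
    ∑ i, ∑ j, ∑ k, ∑ l, gaussCurv c C i j k l * cubicCurv C i j k l =
      -2 * c * cubicNormSq C + ∑ i, ∑ j, ∑ k, ∑ l, cubicCurv C i j k l ^ 2 := by
  have : ∀ i j k l, gaussCurv c C i j k l * cubicCurv C i j k l =
      c * (unitCurv i j k l * cubicCurv C i j k l) + cubicCurv C i j k l ^ 2 := by
    intro i j k l
    rw [gaussCurv]
    ring
  simp only [this, Finset.sum_add_distrib, ← Finset.mul_sum, h.sum_unitCurv_mul_cubicCurv]
  ring

/-- This contraction of the first and third slots is minus the Ricci tensor. -/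
theorem sum_gaussCurv_ricci (h : IsHarmonicCubic C) (c : ℝ) (w m : ι) :
    ∑ v, gaussCurv c C v w v m =
      -c * (Fintype.card ι - 1) * (if w = m then 1 else 0) + cubicGram C w m := by
  have h1 : ∑ v, cubicCurv C v w v m = cubicGram C w m := by
    simp only [cubicCurv, Finset.sum_sub_distrib]
    have e : ∑ v, ∑ t, C v v t * C w m t = 0 := by
      rw [Finset.sum_comm]
      refine Finset.sum_eq_zero fun t _ => ?_
      rw [← Finset.sum_mul, h.trace, zero_mul]
    rw [e, sub_zero, cubicGram]
    exact Finset.sum_congr rfl fun v _ => Finset.sum_congr rfl fun t _ => by rw [h.symm₁₂ v m t]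
  have h2 : ∑ v, unitCurv v w v m = (1 - Fintype.card ι) * (if w = m then 1 else 0) := by
    simp only [unitCurv, Finset.sum_sub_distrib]
    by_cases hwm : w = m <;> simp [hwm]
  simp only [gaussCurv, Finset.sum_add_distrib, ← Finset.mul_sum, h1, h2]
  ring

/-- Contraction of the curvature with two copies of `C`. -/
theorem two_mul_sum_gaussCurv (h : IsHarmonicCubic C) (c : ℝ) :
    2 * ∑ v, ∑ w, ∑ m, ∑ s, gaussCurv c C v w m s * ∑ t, C v t m * C w t s =
      - ∑ v, ∑ w, ∑ m, ∑ s, gaussCurv c C v w m s * cubicCurv C v w m s := by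
  -- Exchanging `v` and `w` changes the sign of the curvature, so the two halves of `cubicCurv`
  -- contribute equally.
  have e : ∑ v, ∑ w, ∑ m, ∑ s, gaussCurv c C v w m s * ∑ t, C w t m * C v t s =
      - ∑ v, ∑ w, ∑ m, ∑ s, gaussCurv c C v w m s * ∑ t, C v t m * C w t s := by
    rw [Finset.sum_comm]
    simp only [← Finset.sum_neg_distrib]
    refine Finset.sum_congr rfl fun v _ => Finset.sum_congr rfl fun w _ =>
      Finset.sum_congr rfl fun m _ => Finset.sum_congr rfl fun s _ => ?_
    rw [gaussCurv_antisymm_left c C w v, neg_mul]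
  have e2 : ∀ v w m s, cubicCurv C v w m s = ∑ t, C w t m * C v t s - ∑ t, C v t m * C w t s := by
    intro v w m s
    rw [cubicCurv, ← Finset.sum_sub_distrib]
    exact Finset.sum_congr rfl fun t _ => by
      rw [h.symm₂₃ w t m, h.symm₂₃ v t s, h.symm₂₃ v t m, h.symm₂₃ w t s]
  simp only [e2, mul_sub, Finset.sum_sub_distrib, e]
  ring

/-- The Simons identity. -/
theorem simons (h : IsHarmonicCubic C) {c : ℝ} (hs : IsSemiparallelCubic c C) :
    (∑ i, ∑ j, ∑ k, ∑ l, cubicCurv C i j k l ^ 2) + ∑ i, ∑ j, cubicGram C i j ^ 2 =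
      (Fintype.card ι + 1) * c * cubicNormSq C := by
  -- The semiparallelity relation with `z = v`, summed over `v` and paired with `C w t s`. Two of
  -- its three terms become the same contraction `Q` of the curvature with two copies of `C`; the
  -- third is `cubicGram` paired with the Ricci contraction.
  have h1 : ∑ v, ∑ w, ∑ t, ∑ s, C w t s * ∑ m, (C v t m * gaussCurv c C v w m s
      - C m t s * gaussCurv c C v w v m - C v m s * gaussCurv c C v w t m) = 0 := by
    simp only [hs _ _ _ _ _, mul_zero, Finset.sum_const_zero]
  set Q := ∑ v, ∑ w, ∑ m, ∑ s, gaussCurv c C v w m s * ∑ t, C v t m * C w t s with hQ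
  have q1 : ∑ v, ∑ w, ∑ t, ∑ s, ∑ m, C w t s * (C v t m * gaussCurv c C v w m s) = Q := by
    refine Finset.sum_congr rfl fun v _ => Finset.sum_congr rfl fun w _ => ?_
    rw [sum_rotate]
    refine Finset.sum_congr rfl fun m _ => ?_
    rw [Finset.sum_comm]
    simp only [Finset.mul_sum]
    exact Finset.sum_congr rfl fun s _ => Finset.sum_congr rfl fun t _ => by ring
  have q2 : ∑ v, ∑ w, ∑ t, ∑ s, ∑ m, C w t s * (C v m s * gaussCurv c C v w t m) = -Q := by
    simp only [hQ, ← Finset.sum_neg_distrib]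
    refine Finset.sum_congr rfl fun v _ => Finset.sum_congr rfl fun w _ => ?_
    rw [sum_rotate]
    refine Finset.sum_congr rfl fun m _ => Finset.sum_congr rfl fun t _ => ?_
    rw [Finset.mul_sum, ← Finset.sum_neg_distrib]
    refine Finset.sum_congr rfl fun s _ => ?_
    rw [gaussCurv_antisymm_right c C v w t m, h.symm₂₃ w t s, h.symm₂₃ v m s]
    ring
  have q3 : ∑ v, ∑ w, ∑ t, ∑ s, ∑ m, C w t s * (C m t s * gaussCurv c C v w v m) =
      ∑ w, ∑ m, cubicGram C w m * ∑ v, gaussCurv c C v w v m := by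
    rw [Finset.sum_comm]
    refine Finset.sum_congr rfl fun w _ => ?_
    simp only [Finset.mul_sum]
    rw [Finset.sum_comm (f := fun m v => cubicGram C w m * gaussCurv c C v w v m)]
    refine Finset.sum_congr rfl fun v _ => ?_
    rw [sum_rotate]
    refine Finset.sum_congr rfl fun m _ => ?_
    simp only [cubicGram, Finset.sum_mul]
    exact Finset.sum_congr rfl fun t _ => Finset.sum_congr rfl fun s _ => by ring
  have h2 : 2 * Q - ∑ w, ∑ m, cubicGram C w m * ∑ v, gaussCurv c C v w v m = 0 := by
    simp only [Finset.mul_sum, mul_sub, Finset.sum_sub_distrib, q1, q2, q3] at h1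
    simp only [Finset.mul_sum] at q3 ⊢
    linarith
  rw [hQ, h.two_mul_sum_gaussCurv, h.sum_gaussCurv_mul_cubicCurv] at h2
  simp only [h.sum_gaussCurv_ricci] at h2
  have h3 : ∑ w, ∑ m, cubicGram C w m * (-c * (Fintype.card ι - 1) * (if w = m then 1 else 0)
      + cubicGram C w m) = -c * (Fintype.card ι - 1) * cubicNormSq C
        + ∑ w, ∑ m, cubicGram C w m ^ 2 := by
    rw [← cubicGram_sum_unit]
    simp only [Finset.mul_sum, ← Finset.sum_add_distrib]
    exact Finset.sum_congr rfl fun w _ => Finset.sum_congr rfl fun m _ => by ring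
  rw [h3] at h2
  linarith

/-- The parameter `r` is free, not necessarily `c`: nonnegativity of the left side bounds
`|cubicCurv|²` below, and the best bound comes from minimizing over `r`. -/
theorem sum_gaussCurv_sq (h : IsHarmonicCubic C) (r : ℝ) :
    ∑ i, ∑ j, ∑ k, ∑ l, gaussCurv r C i j k l ^ 2 =
      2 * r ^ 2 * (Fintype.card ι * (Fintype.card ι - 1)) - 4 * r * cubicNormSq C
        + ∑ i, ∑ j, ∑ k, ∑ l, cubicCurv C i j k l ^ 2 := by
  have : ∀ i j k l, gaussCurv r C i j k l ^ 2 = r ^ 2 * (unitCurv i j k l * unitCurv i j k l)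
      + 2 * r * (unitCurv i j k l * cubicCurv C i j k l) + cubicCurv C i j k l ^ 2 := by
    intro i j k l
    rw [gaussCurv]
    ring
  simp only [this, Finset.sum_add_distrib, ← Finset.mul_sum, h.sum_unitCurv_mul_cubicCurv,
    sum_unitCurv_sq]
  ring

theorem sum_cubicGram_sub_sq (C : ι → ι → ι → ℝ) (r : ℝ) :
    ∑ i, ∑ j, (cubicGram C i j - r * if i = j then 1 else 0) ^ 2 =
      (∑ i, ∑ j, cubicGram C i j ^ 2) - 2 * r * cubicNormSq C + r ^ 2 * Fintype.card ι := by
  have : ∀ i j, (cubicGram C i j - r * if i = j then 1 else 0) ^ 2 = cubicGram C i j ^ 2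
      - 2 * r * (cubicGram C i j * if i = j then 1 else 0) + r ^ 2 * if i = j then 1 else 0 := by
    intro i j
    split_ifs <;> ring
  simp only [this, Finset.sum_add_distrib, Finset.sum_sub_distrib, ← Finset.mul_sum,
    cubicGram_sum_unit]
  simp

theorem cubicNormSq_nonneg (C : ι → ι → ι → ℝ) : 0 ≤ cubicNormSq C := by
  unfold cubicNormSq
  positivity

theorem eq_zero_of_cubicNormSq (h : cubicNormSq C = 0) (i j k : ι) : C i j k = 0 := by
  rw [cubicNormSq, Finset.sum_eq_zero_iff_of_nonneg (fun _ _ => by positivity)] at h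
  have h1 := h i (Finset.mem_univ i)
  rw [Finset.sum_eq_zero_iff_of_nonneg (fun _ _ => by positivity)] at h1
  have h2 := h1 j (Finset.mem_univ j)
  rw [Finset.sum_eq_zero_iff_of_nonneg (fun _ _ => by positivity)] at h2
  exact pow_eq_zero_iff (two_ne_zero) |>.1 (h2 k (Finset.mem_univ k))

/-- If `n ≤ 1`, the quadratic term in `sum_gaussCurv_sq` disappears, leaving a nonnegative affine
function of `r` with slope `-4 S`, which forces `S = 0`. -/
theorem two_le_card (h : IsHarmonicCubic C) (hS : cubicNormSq C ≠ 0) :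
    2 ≤ (Fintype.card ι : ℝ) := by
  by_contra hlt
  have hn : Fintype.card ι = 0 ∨ Fintype.card ι = 1 := by
    have : Fintype.card ι < 2 := by exact_mod_cast not_le.1 hlt
    omega
  set S := cubicNormSq C
  set K := ∑ i, ∑ j, ∑ k, ∑ l, cubicCurv C i j k l ^ 2 with hK
  have hSpos : 0 < S := lt_of_le_of_ne (cubicNormSq_nonneg C) hS.symm
  -- This value of `r` makes the affine function equal to `-1`.
  have e := h.sum_gaussCurv_sq ((K + 1) / (4 * S))
  have e0 : 0 ≤ ∑ i, ∑ j, ∑ k, ∑ l, gaussCurv ((K + 1) / (4 * S)) C i j k l ^ 2 :=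
    sum_sq_nonneg _
  have e1 : (Fintype.card ι : ℝ) * (Fintype.card ι - 1) = 0 := by
    rcases hn with hn | hn <;> simp [hn]
  have e2 : 4 * ((K + 1) / (4 * S)) * S = K + 1 := by field_simp
  rw [e, e1, e2] at e0
  linarith

/-- A nonzero semiparallel trace-free cubic form has non-negative scalar curvature. -/
theorem cubicNormSq_le (h : IsHarmonicCubic C) {c : ℝ} (hs : IsSemiparallelCubic c C)
    (hS : cubicNormSq C ≠ 0) :
    cubicNormSq C ≤ Fintype.card ι * (Fintype.card ι - 1) * c := by
  have hn := h.two_le_card hS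
  have h1 := h.simons hs
  have hSpos : 0 < cubicNormSq C := lt_of_le_of_ne (cubicNormSq_nonneg C) hS.symm
  set S := cubicNormSq C
  set n : ℝ := (Fintype.card ι : ℝ)
  -- `S / (n(n-1))` and, below, `S / n` minimize the two sums of squares, so these are the
  -- Cauchy–Schwarz bounds for `cubicCurv` and `cubicGram`.
  have e1 := h.sum_gaussCurv_sq (S / (n * (n - 1)))
  have e1' : 0 ≤ ∑ i, ∑ j, ∑ k, ∑ l, gaussCurv (S / (n * (n - 1))) C i j k l ^ 2 :=
    sum_sq_nonneg _
  have e2 := sum_cubicGram_sub_sq C (S / n)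
  have e2' : 0 ≤ ∑ i, ∑ j, (cubicGram C i j - S / n * if i = j then 1 else 0) ^ 2 := by positivity
  rw [e1] at e1'
  rw [e2] at e2'
  have hn1 : 0 < n - 1 := by linarith
  have hn0 : 0 < n := by linarith
  have f1 : 2 * (S / (n * (n - 1))) ^ 2 * (n * (n - 1)) - 4 * (S / (n * (n - 1))) * S
      - 2 * (S / n) * S + (S / n) ^ 2 * n = - (S * (n + 1)) * (S / (n * (n - 1))) := by
    field_simp
    ring
  -- The sum of the two bounds, with `|cubicCurv|² + |cubicGram|²` replaced by the Simons identity.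
  have f2 : 0 ≤ S * (n + 1) * (c - S / (n * (n - 1))) := by linarith
  have f3 : 0 ≤ c - S / (n * (n - 1)) := nonneg_of_mul_nonneg_right f2 (by positivity)
  have f4 : S / (n * (n - 1)) ≤ c := by linarith
  rw [div_le_iff₀ (by positivity)] at f4
  linarith

/-- A semiparallel trace-free cubic form with vanishing scalar curvature is flat. -/
theorem gaussCurv_eq_zero (h : IsHarmonicCubic C) {c : ℝ} (hs : IsSemiparallelCubic c C)
    (hτ : Fintype.card ι * (Fintype.card ι - 1) * c - cubicNormSq C = 0) (i j k l : ι) :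
    gaussCurv c C i j k l = 0 := by
  by_cases hS : cubicNormSq C = 0
  · have hC := eq_zero_of_cubicNormSq hS
    have hP : cubicCurv C i j k l = 0 := by simp [cubicCurv, hC]
    rw [hS, sub_zero] at hτ
    rw [gaussCurv, hP, add_zero]
    -- With `C = 0`, either the dimension is at most one, where `unitCurv` vanishes, or `c = 0`.
    rcases mul_eq_zero.1 hτ with hn | hc
    · have : Subsingleton ι := by
        rw [← Fintype.card_le_one_iff_subsingleton]
        rcases mul_eq_zero.1 hn with hn | hn
        · have : Fintype.card ι = 0 := by exact_mod_cast hn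
          omega
        · have : Fintype.card ι = 1 := by
            have : (Fintype.card ι : ℝ) = 1 := by linarith
            exact_mod_cast this
          omega
      obtain rfl := Subsingleton.elim i j
      simp [unitCurv]
    · simp [hc]
  · have hn := h.two_le_card hS
    have h1 := h.simons hs
    have e1 := h.sum_gaussCurv_sq c
    have e2 := sum_cubicGram_sub_sq C (cubicNormSq C / Fintype.card ι)
    have e2' : 0 ≤ ∑ i, ∑ j, (cubicGram C i j - cubicNormSq C / Fintype.card ι *
      if i = j then 1 else 0) ^ 2 := by positivity
    rw [e2] at e2'
    set n : ℝ := (Fintype.card ι : ℝ)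
    have hSc : cubicNormSq C = n * (n - 1) * c := by linarith
    have f1 : cubicNormSq C / n = (n - 1) * c := by
      rw [hSc]
      field_simp
    rw [f1] at e2'
    -- With `S = n(n-1)c`, the Simons identity and `|cubicGram|² ≥ S² / n = (n-1) c S` bound this
    -- sum by `(2 - 4 + (n+1) - (n-1)) c S = 0`.
    have e3 : ∑ i, ∑ j, ∑ k, ∑ l, gaussCurv c C i j k l ^ 2 ≤ 0 := by
      rw [e1]
      rw [hSc] at h1 e2' ⊢
      nlinarith
    have e4 : ∑ i, ∑ j, ∑ k, ∑ l, gaussCurv c C i j k l ^ 2 = 0 :=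
      le_antisymm e3 (sum_sq_nonneg _)
    exact eq_zero_of_sum_sq_eq_zero _ e4 i j k l

end IsHarmonicCubic

end SymmetricTensors

/-! ### Orthonormal bases and metric traces. -/

section Traces

variable {V : Type*} [NormedAddCommGroup V] [NormedSpace ℝ V] [FiniteDimensional ℝ V]

/-- `V` is rebound without a norm, so that the norm defined by `B` is the only one in scope when
`stdOrthonormalBasis` is used. -/
theorem exists_orthonormal_basis {V : Type*} [AddCommGroup V] [Module ℝ V] [FiniteDimensional ℝ V]
    (B : V →ₗ[ℝ] V →ₗ[ℝ] ℝ) (hs : ∀ v w, B v w = B w v) (hp : ∀ v, v ≠ 0 → 0 < B v v) :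
    ∃ e : Module.Basis (Fin (Module.finrank ℝ V)) ℝ V,
      ∀ i j, B (e i) (e j) = if i = j then 1 else 0 := by
  let core : InnerProductSpace.Core ℝ V :=
    { inner := fun v w => B v w
      conj_inner_symm := fun v w => hs w v
      re_inner_nonneg := fun v => by
        by_cases h : v = 0
        · simp [h]
        · exact (hp v h).le
      add_left := fun a b c => by simp
      smul_left := fun a b r => by simp
      definite := fun v hv => by
        by_contra h
        exact (hp v h).ne' hv }
  let _ : NormedAddCommGroup V := core.toNormedAddCommGroup
  let _ : InnerProductSpace ℝ V := InnerProductSpace.ofCore core.toCore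
  refine ⟨(stdOrthonormalBasis ℝ V).toBasis, fun i j => ?_⟩
  have := orthonormal_iff_ite.1 (stdOrthonormalBasis ℝ V).orthonormal i j
  rw [OrthonormalBasis.coe_toBasis]
  exact this

/-- `e` is orthonormal for `B`. -/
def IsOrthonormalFor {ι : Type*} [DecidableEq ι] (B : V →L[ℝ] V →L[ℝ] ℝ)
    (e : Module.Basis ι ℝ V) : Prop :=
  ∀ i j, B (e i) (e j) = if i = j then 1 else 0

theorem IsMetricOn.exists_isOrthonormalFor {g : V → V →L[ℝ] V →L[ℝ] ℝ} {Ω : Set V} {x : V}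
    (hg : IsMetricOn g Ω) (hx : x ∈ Ω) :
    ∃ e : Module.Basis (Fin (Module.finrank ℝ V)) ℝ V, IsOrthonormalFor (g x) e :=
  exists_orthonormal_basis
    (LinearMap.mk₂ ℝ (fun v w => g x v w) (by simp) (by simp) (by simp) (by simp))
    (fun v w => hg.symm x hx v w) (fun v hv => hg.pos x hx v hv)

section

variable {ι : Type*} [Fintype ι] [DecidableEq ι] {B : V →L[ℝ] V →L[ℝ] ℝ} {e : Module.Basis ι ℝ V}

theorem IsOrthonormalFor.apply_eq_repr (he : IsOrthonormalFor B e) (v : V) (i : ι) :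
    B v (e i) = e.repr v i := by
  calc B v (e i) = B (∑ k, e.repr v k • e k) (e i) := by rw [e.sum_repr]
    _ = ∑ k, e.repr v k * if k = i then 1 else 0 := by
      simp only [map_sum, sum_apply, map_smul, smul_apply, he _ _, smul_eq_mul]
    _ = e.repr v i := by simp

theorem IsOrthonormalFor.sum_apply_smul (he : IsOrthonormalFor B e) (v : V) :
    ∑ i, B v (e i) • e i = v := by
  simp only [he.apply_eq_repr, e.sum_repr]

theorem IsOrthonormalFor.parseval (he : IsOrthonormalFor B e) (v w : V) :
    B v w = ∑ i, B v (e i) * B w (e i) := by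
  conv_lhs => rw [← he.sum_apply_smul w]
  simp [mul_comm]

/-- Raising the index of `b^i` gives `∑ b^i(e_l) e_l`; the coefficients then recombine with `b_i`
into `∑ b^i(e_l) b_i = e_l`. -/
theorem IsOrthonormalFor.metricTrace_eq {Z : Type*} [AddCommGroup Z] [Module ℝ Z]
    (he : IsOrthonormalFor B e) (hB : B.IsInvertible) {T : V → V → Z}
    (h₁ : ∀ w, IsLinearMap ℝ fun v => T v w) (h₂ : ∀ v, IsLinearMap ℝ (T v)) :
    metricTrace B T = ∑ i, T (e i) (e i) := by
  set b := Module.finBasis ℝ V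
  have h3 : ∀ i, B.inverse (LinearMap.toContinuousLinearMap (b.coord i)) =
      ∑ l, b.coord i (e l) • e l := by
    intro i
    conv_lhs => rw [← he.sum_apply_smul (B.inverse _)]
    rw [hB.self_apply_inverse]
    rfl
  have h4 : ∀ l, ∑ i, b.coord i (e l) • b i = e l := fun l => b.sum_repr (e l)
  have h5 : ∀ v (c : ι → ℝ), T v (∑ l, c l • e l) = ∑ l, c l • T v (e l) := by
    intro v c
    have := map_sum ((h₂ v).mk' (T v)) (fun l => c l • e l) Finset.univ
    simpa only [IsLinearMap.mk'_apply, (h₂ v).map_smul] using this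
  have h6 : ∀ l, T (e l) (e l) = ∑ i, b.coord i (e l) • T (b i) (e l) := by
    intro l
    have := map_sum ((h₁ (e l)).mk' _) (fun i => b.coord i (e l) • b i) Finset.univ
    rw [h4] at this
    simpa only [IsLinearMap.mk'_apply, (h₁ (e l)).map_smul] using this
  simp only [metricTrace]
  change ∑ i, T (b i) (B.inverse (LinearMap.toContinuousLinearMap (b.coord i))) = _
  simp only [h3, h5, h6]
  exact Finset.sum_comm

end

end Traces

/-! ### Scalar curvature in orthonormal bases; the curvature of complex space forms. -/

section CurvatureLinear

variable {V : Type*} [NormedAddCommGroup V] [NormedSpace ℝ V] [FiniteDimensional ℝ V]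
variable {g : V → V →L[ℝ] V →L[ℝ] ℝ} {Ω : Set V} {x : V}

namespace IsMetricOn

theorem isLinearMap_curv₁ (hg : IsMetricOn g Ω) (hx : x ∈ Ω) (w z : V) :
    IsLinearMap ℝ fun v => curv g x v w z where
  map_add a b := by
    simp only [hg.curv_eq hx, map_add, add_apply]
    abel
  map_smul r a := by
    simp only [hg.curv_eq hx, map_smul, smul_apply]
    module

theorem isLinearMap_curv₂ (hg : IsMetricOn g Ω) (hx : x ∈ Ω) (v z : V) :
    IsLinearMap ℝ fun w => curv g x v w z where
  map_add a b := by
    simp only [hg.curv_eq hx, map_add, add_apply]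
    abel
  map_smul r a := by
    simp only [hg.curv_eq hx, map_smul, smul_apply]
    module

theorem isLinearMap_curv₃ (hg : IsMetricOn g Ω) (hx : x ∈ Ω) (v w : V) :
    IsLinearMap ℝ fun z => curv g x v w z where
  map_add a b := by
    simp only [hg.curv_eq hx, map_add]
    abel
  map_smul r a := by
    simp only [hg.curv_eq hx, map_smul]
    module

theorem isCurvatureForm (hg : IsMetricOn g Ω) (hx : x ∈ Ω) :
    IsCurvatureForm fun a b c d => g x (curv g x a b c) d where
  add_left a a' b c d := by
    simp only [(hg.isLinearMap_curv₁ hx b c).map_add, map_add, add_apply]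
  antisymm_left a b c d := by
    rw [curv_antisymm, map_neg, neg_apply]
  antisymm_right a b c d := hg.curv_skew hx a b c d
  bianchi a b c d := by
    rw [← add_apply, ← add_apply, ← map_add, ← map_add, hg.curv_bianchi hx, map_zero, zero_apply]

theorem scalarCurv_eq {ι : Type*} [Fintype ι] [DecidableEq ι] {e : Module.Basis ι ℝ V}
    (hg : IsMetricOn g Ω) (hx : x ∈ Ω) (he : IsOrthonormalFor (g x) e) :
    scalarCurv g x = ∑ j, ∑ i, g x (curv g x (e i) (e j) (e j)) (e i) := by
  have h1 : ∀ v w, ricci g x v w = ∑ i, g x (curv g x (e i) v w) (e i) := by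
    intro v w
    refine he.metricTrace_eq (hg.isInvertible hx) (fun b => ⟨fun a a' => ?_, fun r a => ?_⟩)
      (fun a => ⟨fun b b' => ?_, fun r b => ?_⟩)
    · simp only [(hg.isLinearMap_curv₁ hx v w).map_add, map_add, add_apply]
    · simp only [(hg.isLinearMap_curv₁ hx v w).map_smul, map_smul, smul_apply]
    · simp
    · simp
  rw [scalarCurv, he.metricTrace_eq (hg.isInvertible hx)]
  · simp only [h1]
  · refine fun w => ⟨fun a a' => ?_, fun r a => ?_⟩
    · simp only [h1, (hg.isLinearMap_curv₂ hx _ w).map_add, map_add, add_apply,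
        Finset.sum_add_distrib]
    · simp only [h1, (hg.isLinearMap_curv₂ hx _ w).map_smul, map_smul, smul_apply,
        Finset.smul_sum]
  · refine fun w => ⟨fun a a' => ?_, fun r a => ?_⟩
    · simp only [h1, (hg.isLinearMap_curv₃ hx _ w).map_add, map_add, add_apply,
        Finset.sum_add_distrib]
    · simp only [h1, (hg.isLinearMap_curv₃ hx _ w).map_smul, map_smul, smul_apply,
        Finset.smul_sum]

end IsMetricOn

/-- `(G, J)` is a Kähler structure on the open set `Θ`. -/
structure IsKahlerOn (G : V → V →L[ℝ] V →L[ℝ] ℝ) (J : V → V →L[ℝ] V) (Θ : Set V) : Prop where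
  metric : IsMetricOn G Θ
  contDiffAt : ∀ y ∈ Θ, ContDiffAt ℝ ∞ J y
  sq : ∀ y ∈ Θ, ∀ a, J y (J y a) = -a
  hermitian : ∀ y ∈ Θ, ∀ a b, G y (J y a) (J y b) = G y a b
  parallel : ∀ y ∈ Θ, ∀ v w, cov G (fun y' => J y' w) y v = J y (cov G (fun _ => w) y v)

namespace IsKahlerOn

variable {G : V → V →L[ℝ] V →L[ℝ] ℝ} {J : V → V →L[ℝ] V} {Θ : Set V} {y : V}

theorem apply_left (h : IsKahlerOn G J Θ) (hy : y ∈ Θ) (a b : V) :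
    G y (J y a) b = -G y a (J y b) := by
  rw [← h.hermitian y hy a (J y b), h.sq y hy, map_neg, neg_neg]

theorem apply_self (h : IsKahlerOn G J Θ) (hy : y ∈ Θ) (a : V) : G y (J y a) a = 0 := by
  have h1 := h.apply_left hy a a
  rw [h.metric.symm y hy a] at h1
  linarith

/-- The curvature tensor of a complex space form. -/
theorem curv_of_holomorphic (h : IsKahlerOn G J Θ) (hy : y ∈ Θ) {μ : ℝ}
    (hol : ∀ a, a ≠ 0 → sectionalCurv G y a (J y a) = μ) (a b c d : V) :
    G y (curv G y a b c) d = μ / 4 * (G y b c * G y a d - G y a c * G y b d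
      + G y (J y b) c * G y (J y a) d - G y (J y a) c * G y (J y b) d
      + 2 * G y a (J y b) * G y (J y c) d) := by
  have hR := h.metric.isCurvatureForm hy
  have hs := h.metric.symm y hy
  have hl := h.apply_left hy
  -- The difference from the model is a `J`-invariant curvature form with zero holomorphic sectional
  -- curvature, hence zero.
  have key : IsCurvatureForm fun a b c d => G y (curv G y a b c) d
      - μ / 4 * (G y b c * G y a d - G y a c * G y b d
      + G y (J y b) c * G y (J y a) d - G y (J y a) c * G y (J y b) d
      + 2 * G y a (J y b) * G y (J y c) d) := by
    constructor
    · intro a a' b c d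
      have := hR.add_left a a' b c d
      simp only [map_add, add_apply] at this ⊢
      rw [this]
      ring
    · intro a b c d
      have := hR.antisymm_left a b c d
      rw [this, hs a (J y b), hl b a]
      ring
    · intro a b c d
      have := hR.antisymm_right a b c d
      rw [this, hl c d, hs c (J y d)]
      ring
    · intro a b c d
      have := hR.bianchi a b c d
      rw [hs c a, hs c b, hs b a, hl a b, hl c b, hl c a, hs c (J y b), hl b c, hs c (J y a), hl a c,
        hs (J y b) a]
      linear_combination this
  refine sub_eq_zero.1 (key.eq_zero_of_holomorphic (J := J y) (map_add _) (map_neg _) (h.sq y hy)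
    ?_ ?_ a b c d)
  · intro a b c d
    have h1 := h.metric.curv_parallel hy h.contDiffAt h.parallel a b c
    simp only [h1, h.hermitian y hy, h.sq y hy, map_neg, neg_apply]
    simp only [hl a, hl b, hl c]
    ring
  · intro a
    by_cases ha : a = 0
    · simp [ha]
    · have h1 := hol a ha
      have h2 := h.metric.pos y hy a ha
      rw [sectionalCurv, h.hermitian y hy, hs a (J y a), h.apply_self hy, div_eq_iff] at h1
      · simp only [h1, h.sq y hy, map_neg, neg_apply, h.hermitian y hy, hs a (J y a),
          h.apply_self hy]
        ring
      · have : 0 < G y a a * G y a a := by positivity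
        nlinarith

end IsKahlerOn

end CurvatureLinear

/-! ### Totally real immersions with parallel `f`: reduction to the cubic form. -/

section TotallyRealLocal

variable {V : Type*} [NormedAddCommGroup V] [NormedSpace ℝ V] [FiniteDimensional ℝ V]
variable {W : Type*} [NormedAddCommGroup W] [NormedSpace ℝ W] [FiniteDimensional ℝ W]
variable {G : W → W →L[ℝ] W →L[ℝ] ℝ} {J : W → W →L[ℝ] W} {Θ : Set W} {u : V → W} {U : Set V}
  {x : V}

/-- `u` immerses `U` into the Kähler domain `Θ`, is totally real at `x ∈ U`, and its `f`-structure
is parallel at `x`. -/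
structure IsTotallyRealAt (G : W → W →L[ℝ] W →L[ℝ] ℝ) (J : W → W →L[ℝ] W) (Θ : Set W)
    (u : V → W) (U : Set V) (x : V) : Prop where
  kahler : IsKahlerOn G J Θ
  immersion : IsImmersionInto u U Θ
  mem : x ∈ U
  real : ∀ v w, G (u x) (J (u x) (fderiv ℝ u x v)) (fderiv ℝ u x w) = 0
  parallel : ParallelFAt G J u x

/-- The cubic form `⟨σ(v, w), J t⟩`. -/
def cubicForm (G : W → W →L[ℝ] W →L[ℝ] ℝ) (J : W → W →L[ℝ] W) (u : V → W) (x v w t : V) : ℝ :=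
  G (u x) (sff G u x v w) (J (u x) (fderiv ℝ u x t))

namespace IsTotallyRealAt

theorem metric (h : IsTotallyRealAt G J Θ u U x) : IsMetricOn G Θ := h.kahler.metric

theorem mem' (h : IsTotallyRealAt G J Θ u U x) : u x ∈ Θ := h.immersion.mapsTo x h.mem

theorem contDiffAt (h : IsTotallyRealAt G J Θ u U x) : ContDiffAt ℝ ∞ u x :=
  h.immersion.contDiffAt x h.mem

theorem induced (h : IsTotallyRealAt G J Θ u U x) : IsMetricOn (inducedMetric G u) U :=
  h.metric.inducedMetric h.immersion

/-- Parallelity of `f` expresses `σ(v, Jξ)` through the shape operator of `ξ`. -/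
theorem exists_shape (h : IsTotallyRealAt G J Θ u U x) (v w : V) :
    ∃ a : V, sff G u x v w = J (u x) (fderiv ℝ u x a) ∧
      ∀ s, inducedMetric G u x a s = cubicForm G J u x v s w := by
  have hu := h.immersion
  have hx := h.mem
  have hG := h.metric
  set ξ₀ := J (u x) (fderiv ℝ u x w) with hξ₀
  -- Projecting the constant vector `ξ₀` gives a normal field near `x`; its value at `x` is `ξ₀`
  -- itself, by total reality.
  set ξ : V → W := fun y => normalPart G u y ξ₀ with hξdef
  have hξ : IsNormalFieldAt G u ξ x := hG.isNormalFieldAt_normalPart hu hx contDiffAt_const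
  have hξx : ξ x = ξ₀ := hG.normalPart_of_normal hu hx (h.real w)
  have hJξ : ContDiffAt ℝ ∞ (fun y => J (u y) (ξ y)) x :=
    ((h.kahler.contDiffAt _ h.mem').comp x h.contDiffAt).clm_apply hξ.1
  have hT := hG.contDiffAt_tangentialPart hu hx hJξ
  have hu3 : ContDiffAt ℝ ∞ (fderiv ℝ u) x := h.contDiffAt.fderiv_right (by simp)
  have hcov : covAlong G u (fun y => J (u y) (ξ y)) x v = J (u x) (covAlong G u ξ x v) :=
    IsMetricOn.covAlong_parallel rfl ((h.kahler.contDiffAt _ h.mem').differentiableAt (by simp))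
      (h.contDiffAt.differentiableAt (by simp)) (hξ.1.differentiableAt (by simp))
      (h.kahler.parallel _ h.mem') v
  -- `f ξ` is `J ξ` minus its tangential part, which at `x` is `J J w = -w`. By the Gauss formula,
  -- differentiating that part contributes `σ(v, w)`.
  have e1 : normalCov G u (fun y => normalF G J u y (ξ y)) x v =
      normalPart G u x (J (u x) (covAlong G u ξ x v)) + sff G u x v w := by
    have e2 : tangentialPart G u x (J (u x) (ξ x)) = -w := by
      rw [hξx, hξ₀, h.kahler.sq _ h.mem', ← map_neg, hG.tangentialPart_fderiv hu hx]
    have e3 := hG.normalCov_fderiv hu hx (hT.differentiableAt (by simp)) v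
    have e4 : sff G u x v (-w) = - sff G u x v w :=
      (IsMetricOn.sffL G u x h.contDiffAt v).map_neg w
    rw [e2, e4] at e3
    change normalPart G u x (covAlong G u (fun y => J (u y) (ξ y) -
      fderiv ℝ u y (tangentialPart G u y (J (u y) (ξ y)))) x v) = _
    rw [covAlong_sub (hJξ.differentiableAt (by simp)) ((hu3.clm_apply hT).differentiableAt (by simp)),
      normalPart_sub, hcov]
    rw [normalCov] at e3
    rw [e3, sub_neg_eq_add]
  -- Both sides contain the normal part of `J (∇̃_v ξ)`; cancelling it leaves `σ(v, w) = -J (∇̃_v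
  -- ξ)^⊤`.
  have e5 := h.parallel ξ hξ v
  rw [e1, normalF, normalCov_eq, map_sub, normalPart_sub,
    hG.normalPart_of_normal hu hx (h.real _)] at e5
  refine ⟨-tangentialPart G u x (covAlong G u ξ x v), ?_, fun s => ?_⟩
  · rw [map_neg, map_neg]
    have := sub_eq_zero.2 e5
    rw [← sub_eq_zero, ← this]
    abel
  · rw [map_neg, neg_apply, inducedMetric_apply, hG.inner_tangentialPart hu hx,
      hG.inner_covAlong_normal hu hx hξ, neg_neg, hξx, cubicForm, hG.symm _ h.mem']

theorem cubicForm_symm₁₂ (h : IsTotallyRealAt G J Θ u U x) (v w t : V) :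
    cubicForm G J u x v w t = cubicForm G J u x w v t := by
  rw [cubicForm, h.metric.sff_symm h.immersion h.mem, cubicForm]

/-- With `σ(v, w) = J a`, the isometry `J` gives `C(v, w, t) = ⟨a, t⟩`, which the shape-operator
description of `a` evaluates as `C(v, t, w)`. -/
theorem cubicForm_symm₂₃ (h : IsTotallyRealAt G J Θ u U x) (v w t : V) :
    cubicForm G J u x v w t = cubicForm G J u x v t w := by
  obtain ⟨a, ha, ha'⟩ := h.exists_shape v w
  rw [← ha', cubicForm, ha, h.kahler.hermitian _ h.mem', inducedMetric_apply]

/-- The shape operator: `σ(v, w) = J (shape v w)`. -/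
def shape (h : IsTotallyRealAt G J Θ u U x) (v w : V) : V := (h.exists_shape v w).choose

theorem sff_eq_shape (h : IsTotallyRealAt G J Θ u U x) (v w : V) :
    sff G u x v w = J (u x) (fderiv ℝ u x (h.shape v w)) := (h.exists_shape v w).choose_spec.1

theorem shape_apply (h : IsTotallyRealAt G J Θ u U x) (v w t : V) :
    inducedMetric G u x (h.shape v w) t = cubicForm G J u x v w t := by
  rw [h.cubicForm_symm₂₃]
  exact (h.exists_shape v w).choose_spec.2 t

variable {ι : Type*} [Fintype ι] [DecidableEq ι] {e : Module.Basis ι ℝ V}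

theorem inner_sff_sff (h : IsTotallyRealAt G J Θ u U x)
    (he : IsOrthonormalFor (inducedMetric G u x) e) (v w v' w' : V) :
    G (u x) (sff G u x v w) (sff G u x v' w') =
      ∑ m, cubicForm G J u x v w (e m) * cubicForm G J u x v' w' (e m) := by
  rw [h.sff_eq_shape v w, h.sff_eq_shape v' w', h.kahler.hermitian _ h.mem', ← inducedMetric_apply,
    he.parseval]
  simp only [h.shape_apply]

theorem cubicForm_eq_sum (h : IsTotallyRealAt G J Θ u U x)
    (he : IsOrthonormalFor (inducedMetric G u x) e) (v w t : V) :
    cubicForm G J u x v w t = ∑ m, cubicForm G J u x v w (e m) * inducedMetric G u x t (e m) := by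
  rw [← h.shape_apply, he.parseval]
  simp only [h.shape_apply]

/-- The components of the cubic form in the basis `e`. -/
def cubicComp (G : W → W →L[ℝ] W →L[ℝ] ℝ) (J : W → W →L[ℝ] W) (u : V → W) (x : V)
    (e : Module.Basis ι ℝ V) (i j k : ι) : ℝ := cubicForm G J u x (e i) (e j) (e k)

/-- The Gauss equation: total reality removes every `J`-term of the ambient curvature, and the
products of `σ` expand in components of `C`. -/
theorem inducedMetric_curv (h : IsTotallyRealAt G J Θ u U x)
    (he : IsOrthonormalFor (inducedMetric G u x) e) {μ : ℝ}
    (hol : ∀ a, a ≠ 0 → sectionalCurv G (u x) a (J (u x) a) = μ) (i j k l : ι) :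
    inducedMetric G u x (curv (inducedMetric G u) x (e i) (e j) (e k)) (e l) =
      gaussCurv (μ / 4) (cubicComp G J u x e) i j k l := by
  have h1 := h.metric.gauss h.immersion h.mem (e i) (e j) (e k) (e l)
  rw [h.kahler.curv_of_holomorphic h.mem' hol, h.inner_sff_sff he, h.inner_sff_sff he,
    h.metric.symm _ h.mem' _ (J (u x) _)] at h1
  simp only [h.real, ← inducedMetric_apply, he _ _] at h1
  simp only [gaussCurv, unitCurv, cubicCurv, Finset.sum_sub_distrib, cubicComp]
  linarith

theorem isHarmonicCubic (h : IsTotallyRealAt G J Θ u U x)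
    (he : IsOrthonormalFor (inducedMetric G u x) e) (hmin : meanCurv G u x = 0) :
    IsHarmonicCubic (cubicComp G J u x e) where
  symm₁₂ i j k := h.cubicForm_symm₁₂ _ _ _
  symm₂₃ i j k := h.cubicForm_symm₂₃ _ _ _
  trace k := by
    have h1 : metricTrace (inducedMetric G u x) (sff G u x) = 0 := by
      -- The factor `1 / n` is zero when `n = 0`; the trace is then an empty sum.
      rcases smul_eq_zero.1 hmin with h0 | h0
      · have h2 : Module.finrank ℝ V = 0 := by
          simpa using h0
        have : IsEmpty (Fin (Module.finrank ℝ V)) := by rw [h2]; infer_instance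
        simp [metricTrace]
      · exact h0
    rw [he.metricTrace_eq (T := sff G u x) (h.induced.isInvertible h.mem)
      (fun w => ((IsMetricOn.sffL G u x h.contDiffAt).flip w).isLinear)
      (fun v => (IsMetricOn.sffL G u x h.contDiffAt v).isLinear)] at h1
    have h2 := congrArg (fun a => G (u x) a (J (u x) (fderiv ℝ u x (e k)))) h1
    simpa [cubicComp, cubicForm] using h2

theorem sffNormSq_eq (h : IsTotallyRealAt G J Θ u U x)
    (he : IsOrthonormalFor (inducedMetric G u x) e) :
    sffNormSq G u x = cubicNormSq (cubicComp G J u x e) := by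
  have hi := h.induced.isInvertible h.mem
  let σ := IsMetricOn.sffL G u x h.contDiffAt
  have hσ₁ : ∀ a b w, sff G u x (a + b) w = sff G u x a w + sff G u x b w := σ.map_add₂
  have hσ₂ : ∀ (r : ℝ) a w, sff G u x (r • a) w = r • sff G u x a w := σ.map_smul₂
  have hσ₃ : ∀ w a b, sff G u x w (a + b) = sff G u x w a + sff G u x w b := fun w => (σ w).map_add
  have hσ₄ : ∀ w (r : ℝ) a, sff G u x w (r • a) = r • sff G u x w a := fun w => (σ w).map_smul
  have h1 : ∀ v v', metricTrace (inducedMetric G u x) (fun w w' =>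
      G (u x) (sff G u x v w) (sff G u x v' w')) =
      ∑ j, G (u x) (sff G u x v (e j)) (sff G u x v' (e j)) := by
    intro v v'
    refine he.metricTrace_eq hi (fun w => ⟨fun a b => ?_, fun r a => ?_⟩)
      (fun w => ⟨fun a b => ?_, fun r a => ?_⟩) <;> simp [hσ₃, hσ₄]
  simp only [sffNormSq, h1]
  rw [he.metricTrace_eq hi]
  · simp only [h.inner_sff_sff he, cubicNormSq, cubicComp, sq]
  · refine fun w => ⟨fun a b => ?_, fun r a => ?_⟩
    · simp [hσ₁, Finset.sum_add_distrib]
    · simp [hσ₂, Finset.mul_sum]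
  · refine fun w => ⟨fun a b => ?_, fun r a => ?_⟩
    · simp [hσ₁, Finset.sum_add_distrib]
    · simp [hσ₂, Finset.mul_sum]

theorem scalarCurv_eq (h : IsTotallyRealAt G J Θ u U x)
    (he : IsOrthonormalFor (inducedMetric G u x) e) {μ : ℝ}
    (hol : ∀ a, a ≠ 0 → sectionalCurv G (u x) a (J (u x) a) = μ) (hmin : meanCurv G u x = 0) :
    scalarCurv (inducedMetric G u) x =
      Fintype.card ι * (Fintype.card ι - 1) * (μ / 4) - sffNormSq G u x := by
  have hC := h.isHarmonicCubic he hmin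
  rw [h.induced.scalarCurv_eq h.mem he, h.sffNormSq_eq he, Finset.sum_comm]
  simp only [h.inducedMetric_curv he hol, gaussCurv, Finset.sum_add_distrib, ← Finset.mul_sum,
    hC.sum_cubicCurv_trace]
  have : ∀ i j : ι, unitCurv i j j i = 1 - if i = j then 1 else 0 := by
    intro i j
    by_cases hij : i = j <;> simp [unitCurv, hij]
  simp only [this, Finset.sum_sub_distrib]
  simp
  ring

/-- Pair semiparallelity with `J e_s`. In the Ricci equation the ambient term gives `c • unitCurv`
and the shape terms give `cubicCurv`, so `R^⊥` acts on `J(TM)` as `R` acts on `TM`. -/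
theorem isSemiparallelCubic (h : IsTotallyRealAt G J Θ u U x)
    (he : IsOrthonormalFor (inducedMetric G u x) e) {μ : ℝ}
    (hol : ∀ a, a ≠ 0 → sectionalCurv G (u x) a (J (u x) a) = μ)
    (hsemi : SemiparallelAt G u x) :
    IsSemiparallelCubic (μ / 4) (cubicComp G J u x e) := by
  intro v w z t s
  have hG := h.metric
  have hu := h.immersion
  have hx := h.mem
  have hσ := hG.isNormalFieldAt_sff hu hx (e z) (e t)
  have h1 := hsemi (e v) (e w) (e z) (e t)
  rw [hG.normalCurv_eq hu hx hσ] at h1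
  have h2 := congrArg (fun a => G (u x) a (J (u x) (fderiv ℝ u x (e s)))) h1
  simp only [map_sub, map_add, sub_apply, add_apply, map_zero, zero_apply] at h2
  have hsh : ∀ v w, G (u x) (sff G u x (e v) (tangentialPart G u x
      (covAlong G u (fun y => sff G u y (e z) (e t)) x (e w)))) (J (u x) (fderiv ℝ u x (e s))) =
      - ∑ m, cubicComp G J u x e z t m * ∑ r, cubicComp G J u x e w m r * cubicComp G J u x e v s r := by
    intro v w
    rw [← cubicForm, h.cubicForm_symm₂₃, h.cubicForm_eq_sum he]
    have : ∀ r, inducedMetric G u x (tangentialPart G u x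
        (covAlong G u (fun y => sff G u y (e z) (e t)) x (e w))) (e r) =
        - ∑ m, cubicComp G J u x e z t m * cubicComp G J u x e w r m := by
      intro r
      rw [inducedMetric_apply, hG.inner_tangentialPart hu hx, hG.inner_covAlong_normal hu hx hσ,
        h.inner_sff_sff he]
      rfl
    simp only [this, mul_neg, Finset.sum_neg_distrib, Finset.mul_sum]
    rw [Finset.sum_comm]
    refine congrArg _ (Finset.sum_congr rfl fun m _ => Finset.sum_congr rfl fun r _ => ?_)
    simp only [cubicComp]
    rw [h.cubicForm_symm₂₃ (e w) (e r) (e m)]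
    ring
  have hR1 : G (u x) (sff G u x (curv (inducedMetric G u) x (e v) (e w) (e z)) (e t))
      (J (u x) (fderiv ℝ u x (e s))) =
      ∑ m, cubicComp G J u x e m t s * gaussCurv (μ / 4) (cubicComp G J u x e) v w z m := by
    rw [← cubicForm, h.cubicForm_symm₁₂, h.cubicForm_symm₂₃, h.cubicForm_eq_sum he]
    simp only [h.inducedMetric_curv he hol]
    refine Finset.sum_congr rfl fun m _ => ?_
    rw [h.cubicForm_symm₂₃ (e t), h.cubicForm_symm₁₂ (e t)]
    rfl
  have hR2 : G (u x) (sff G u x (e z) (curv (inducedMetric G u) x (e v) (e w) (e t)))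
      (J (u x) (fderiv ℝ u x (e s))) =
      ∑ m, cubicComp G J u x e z m s * gaussCurv (μ / 4) (cubicComp G J u x e) v w t m := by
    rw [← cubicForm, h.cubicForm_symm₂₃, h.cubicForm_eq_sum he]
    simp only [h.inducedMetric_curv he hol]
    refine Finset.sum_congr rfl fun m _ => ?_
    rw [h.cubicForm_symm₂₃ (e z)]
    rfl
  have hn : G (u x) (normalPart G u x (curv G (u x) (fderiv ℝ u x (e v)) (fderiv ℝ u x (e w))
      (sff G u x (e z) (e t)))) (J (u x) (fderiv ℝ u x (e s))) =
      μ / 4 * ∑ m, cubicComp G J u x e z t m * unitCurv v w m s := by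
    -- The projection drops out because `J e_s` is normal. Normality of `σ` and total reality leave
    -- only the two terms that pair `J e_v, J e_w` with `σ` and `J e_s`.
    rw [hG.inner_normalPart_of_normal hu hx (h.real _), h.kahler.curv_of_holomorphic h.mem' hol,
      hG.symm _ h.mem' (fderiv ℝ u x (e w)) (sff G u x (e z) (e t)),
      hG.symm _ h.mem' (fderiv ℝ u x (e v)) (sff G u x (e z) (e t)),
      hG.inner_sff hu hx, hG.inner_sff hu hx, h.kahler.hermitian _ h.mem',
      h.kahler.hermitian _ h.mem', hG.symm _ h.mem' (fderiv ℝ u x (e v)) (J (u x) (fderiv ℝ u x (e w))), h.real,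
      hG.symm _ h.mem' (J (u x) (fderiv ℝ u x (e w))) (sff G u x _ _),
      hG.symm _ h.mem' (J (u x) (fderiv ℝ u x (e v))) (sff G u x _ _),
      ← cubicForm, ← cubicForm, ← inducedMetric_apply, ← inducedMetric_apply, he, he]
    have : ∀ m, cubicComp G J u x e z t m * unitCurv v w m s =
        (if w = m then cubicComp G J u x e z t m * (if v = s then 1 else 0) else 0)
        - (if v = m then cubicComp G J u x e z t m * (if w = s then 1 else 0) else 0) := by
      intro m
      rw [unitCurv]
      split_ifs <;> ring
    simp only [this, Finset.sum_sub_distrib, Finset.sum_ite_eq, Finset.mem_univ, if_true]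
    simp only [cubicComp]
    ring
  rw [hn, hsh, hsh, hR1, hR2] at h2
  rw [← h2, Finset.sum_sub_distrib, Finset.sum_sub_distrib]
  simp only [gaussCurv, cubicCurv, mul_add, Finset.sum_add_distrib, Finset.sum_sub_distrib, mul_sub,
    Finset.mul_sum]
  simp only [mul_left_comm]
  ring

theorem sff_eq_zero (h : IsTotallyRealAt G J Θ u U x) (hS : sffNormSq G u x = 0) (v w : V) :
    sff G u x v w = 0 := by
  obtain ⟨e, he⟩ := h.induced.exists_isOrthonormalFor h.mem
  rw [h.sffNormSq_eq he] at hS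
  have hC := IsHarmonicCubic.eq_zero_of_cubicNormSq hS
  have h1 : ∀ i j, sff G u x (e i) (e j) = 0 := by
    intro i j
    have h2 : h.shape (e i) (e j) = 0 := by
      rw [← he.sum_apply_smul (h.shape (e i) (e j))]
      refine Finset.sum_eq_zero fun k _ => ?_
      rw [h.shape_apply, show cubicForm G J u x (e i) (e j) (e k) = 0 from hC i j k, zero_smul]
    rw [h.sff_eq_shape, h2, map_zero, map_zero]
  have h3 : IsMetricOn.sffL G u x h.contDiffAt = 0 :=
    e.ext fun i => e.ext fun j => h1 i j
  exact congrArg (fun T : V →ₗ[ℝ] V →ₗ[ℝ] W => T v w) h3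

theorem scalarCurv_nonneg (h : IsTotallyRealAt G J Θ u U x) {μ : ℝ}
    (hol : ∀ a, a ≠ 0 → sectionalCurv G (u x) a (J (u x) a) = μ) (hmin : meanCurv G u x = 0)
    (hsemi : SemiparallelAt G u x) (hS : sffNormSq G u x ≠ 0) :
    0 ≤ scalarCurv (inducedMetric G u) x := by
  obtain ⟨e, he⟩ := h.induced.exists_isOrthonormalFor h.mem
  rw [h.scalarCurv_eq he hol hmin, h.sffNormSq_eq he]
  rw [h.sffNormSq_eq he] at hS
  exact sub_nonneg.2 ((h.isHarmonicCubic he hmin).cubicNormSq_le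
    (h.isSemiparallelCubic he hol hsemi) hS)

theorem curv_eq_zero (h : IsTotallyRealAt G J Θ u U x) {μ : ℝ}
    (hol : ∀ a, a ≠ 0 → sectionalCurv G (u x) a (J (u x) a) = μ) (hmin : meanCurv G u x = 0)
    (hsemi : SemiparallelAt G u x) (hτ : scalarCurv (inducedMetric G u) x = 0) (v w z : V) :
    curv (inducedMetric G u) x v w z = 0 := by
  obtain ⟨e, he⟩ := h.induced.exists_isOrthonormalFor h.mem
  rw [h.scalarCurv_eq he hol hmin, h.sffNormSq_eq he] at hτ
  have h0 := (h.isHarmonicCubic he hmin).gaussCurv_eq_zero (h.isSemiparallelCubic he hol hsemi) hτ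
  have h1 : ∀ i j k, curv (inducedMetric G u) x (e i) (e j) (e k) = 0 := by
    intro i j k
    rw [← he.sum_apply_smul (curv (inducedMetric G u) x (e i) (e j) (e k))]
    refine Finset.sum_eq_zero fun l _ => ?_
    rw [h.inducedMetric_curv he hol, h0, zero_smul]
  have h2 : ∀ i j, curv (inducedMetric G u) x (e i) (e j) z = 0 := fun i j =>
    LinearMap.congr_fun (e.ext (f₁ := (h.induced.isLinearMap_curv₃ h.mem (e i) (e j)).mk' _)
      (f₂ := 0) fun k => h1 i j k) z
  have h3 : ∀ i, curv (inducedMetric G u) x (e i) w z = 0 := fun i =>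
    LinearMap.congr_fun (e.ext (f₁ := (h.induced.isLinearMap_curv₂ h.mem (e i) z).mk' _)
      (f₂ := 0) fun j => h2 i j) w
  exact LinearMap.congr_fun (e.ext (f₁ := (h.induced.isLinearMap_curv₁ h.mem w z).mk' _)
    (f₂ := 0) fun i => h3 i) v

end IsTotallyRealAt

end TotallyRealLocal

/-! ### Passage from manifolds to charts. -/

section Charts

variable {E : Type*} [NormedAddCommGroup E] [NormedSpace ℝ E] [FiniteDimensional ℝ E]
variable {M : Type*} [TopologicalSpace M] [ChartedSpace E M] [IsManifold 𝓘(ℝ, E) ∞ M]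
variable {E' : Type*} [NormedAddCommGroup E'] [NormedSpace ℝ E'] [FiniteDimensional ℝ E']
variable {N : Type*} [TopologicalSpace N] [ChartedSpace E' N] [IsManifold 𝓘(ℝ, E') ∞ N]

theorem contMDiffAt_tangentMap {X : Type*} [NormedAddCommGroup X] [NormedSpace ℝ X]
    {f : M → N} {s : Set M} (hs : IsOpen s)
    (hf : ContMDiffOn 𝓘(ℝ, E) 𝓘(ℝ, E') ∞ f s) {ζ : X → TangentBundle 𝓘(ℝ, E) M} {x : X}
    (hζ : ContMDiffAt 𝓘(ℝ, X) 𝓘(ℝ, E).tangent ∞ ζ x) (hx : (ζ x).proj ∈ s) :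
    ContMDiffAt 𝓘(ℝ, X) 𝓘(ℝ, E').tangent ∞ (fun y => tangentMap 𝓘(ℝ, E) 𝓘(ℝ, E') f (ζ y)) x := by
  have h1 := hf.contMDiffOn_tangentMapWithin (m := ∞) (by simp) hs.uniqueMDiffOn
  have hopen : IsOpen (Bundle.TotalSpace.proj ⁻¹' s : Set (TangentBundle 𝓘(ℝ, E) M)) :=
    hs.preimage (FiberBundle.continuous_proj E (TangentSpace 𝓘(ℝ, E)))
  have h2 : ContMDiffAt 𝓘(ℝ, E).tangent 𝓘(ℝ, E').tangent ∞ (tangentMapWithin 𝓘(ℝ, E) 𝓘(ℝ, E') f s)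
      (ζ x) := h1.contMDiffAt (hopen.mem_nhds hx)
  have h3 : tangentMapWithin 𝓘(ℝ, E) 𝓘(ℝ, E') f s =ᶠ[𝓝 (ζ x)] tangentMap 𝓘(ℝ, E) 𝓘(ℝ, E') f := by
    filter_upwards [hopen.mem_nhds hx] with p hp
    simp only [tangentMapWithin, tangentMap, mfderivWithin_of_isOpen hs hp]
  exact (h2.congr_of_eventuallyEq h3.symm).comp x hζ

variable {q : N} {y : E'}

theorem mfderiv_extChartAt_mfderiv_symm (hy : y ∈ (extChartAt 𝓘(ℝ, E') q).target) (a : E') :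
    mfderiv 𝓘(ℝ, E') 𝓘(ℝ, E') (extChartAt 𝓘(ℝ, E') q) ((extChartAt 𝓘(ℝ, E') q).symm y)
      (mfderiv 𝓘(ℝ, E') 𝓘(ℝ, E') (extChartAt 𝓘(ℝ, E') q).symm y a) = a := by
  have : IsManifold 𝓘(ℝ, E') 1 N := IsManifold.of_le (n := ∞) (by simp)
  have h := mfderiv_extChartAt_comp_mfderivWithin_extChartAt_symm (I := 𝓘(ℝ, E')) (x := q) hy
  rw [ModelWithCorners.range_eq_univ, mfderivWithin_univ] at h
  exact congrArg (fun T : E' →L[ℝ] E' => T a) h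

theorem mfderiv_symm_mfderiv_extChartAt (hy : y ∈ (extChartAt 𝓘(ℝ, E') q).target)
    (a : TangentSpace 𝓘(ℝ, E') ((extChartAt 𝓘(ℝ, E') q).symm y)) :
    mfderiv 𝓘(ℝ, E') 𝓘(ℝ, E') (extChartAt 𝓘(ℝ, E') q).symm y
      (mfderiv 𝓘(ℝ, E') 𝓘(ℝ, E') (extChartAt 𝓘(ℝ, E') q) ((extChartAt 𝓘(ℝ, E') q).symm y) a)
      = a := by
  have : IsManifold 𝓘(ℝ, E') 1 N := IsManifold.of_le (n := ∞) (by simp)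
  have h := mfderivWithin_extChartAt_symm_comp_mfderiv_extChartAt (I := 𝓘(ℝ, E')) (x := q) hy
  rw [ModelWithCorners.range_eq_univ, mfderivWithin_univ] at h
  exact congrArg (fun T : E' →L[ℝ] E' => T a) h

/-- The coordinate vector fields are smooth. -/
theorem contMDiffAt_coordField (hy : y ∈ (extChartAt 𝓘(ℝ, E') q).target) (a : E') :
    ContMDiffAt 𝓘(ℝ, E') 𝓘(ℝ, E').tangent ∞
      (fun z => (TotalSpace.mk' E' ((extChartAt 𝓘(ℝ, E') q).symm z)
        (mfderiv 𝓘(ℝ, E') 𝓘(ℝ, E') (extChartAt 𝓘(ℝ, E') q).symm z a) :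
          TangentBundle 𝓘(ℝ, E') N)) y := by
  have h0 : ContMDiffAt 𝓘(ℝ, E') 𝓘(ℝ, E').tangent ∞
      (fun z => (TotalSpace.mk' E' z a : TangentBundle 𝓘(ℝ, E') E')) y :=
    contMDiffAt_vectorSpace_iff_contDiffAt.2 contDiffAt_const
  exact contMDiffAt_tangentMap (isOpen_extChartAt_target q) (contMDiffOn_extChartAt_symm q) h0 hy

variable (g : ContMDiffRiemannianMetric 𝓘(ℝ, E') ∞ E' (fun q : N => TangentSpace 𝓘(ℝ, E') q))

/-- Smoothness of the metric as a bundle section, tested on smooth coordinate fields; finite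
dimension then upgrades it to smoothness of `chartMetric` itself. -/
theorem contDiffAt_chartMetric_apply (hy : y ∈ (extChartAt 𝓘(ℝ, E') q).target) (a b : E') :
    ContDiffAt ℝ ∞ (fun z => chartMetric g q z a b) y := by
  have ha := contMDiffAt_coordField hy a
  have hb := contMDiffAt_coordField hy b
  have hφ : ContMDiffAt 𝓘(ℝ, E') 𝓘(ℝ, E') ∞ (extChartAt 𝓘(ℝ, E') q).symm y :=
    (contMDiffOn_extChartAt_symm q).contMDiffAt ((isOpen_extChartAt_target q).mem_nhds hy)
  have : ContMDiffAt 𝓘(ℝ, E') (𝓘(ℝ, E').prod 𝓘(ℝ)) ∞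
      (fun z => TotalSpace.mk' ℝ (E := Bundle.Trivial N ℝ) ((extChartAt 𝓘(ℝ, E') q).symm z)
        (g.inner ((extChartAt 𝓘(ℝ, E') q).symm z)
          (mfderiv 𝓘(ℝ, E') 𝓘(ℝ, E') (extChartAt 𝓘(ℝ, E') q).symm z a)
          (mfderiv 𝓘(ℝ, E') 𝓘(ℝ, E') (extChartAt 𝓘(ℝ, E') q).symm z b))) y := by
    apply ContMDiffAt.clm_bundle_apply₂ (F₁ := E') (F₂ := E')
    · exact ContMDiffAt.comp y g.contMDiff.contMDiffAt hφ
    · exact ha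
    · exact hb
  rw [contMDiffAt_totalSpace] at this
  exact this.2.contDiffAt

variable {J : ∀ q : N, TangentSpace 𝓘(ℝ, E') q →L[ℝ] TangentSpace 𝓘(ℝ, E') q}

theorem contDiffAt_chartEnd_apply
    (hJ : ContMDiff 𝓘(ℝ, E') (𝓘(ℝ, E').prod 𝓘(ℝ, E' →L[ℝ] E')) ∞
      (fun q => TotalSpace.mk' (E' →L[ℝ] E')
        (E := fun q : N => TangentSpace 𝓘(ℝ, E') q →L[ℝ] TangentSpace 𝓘(ℝ, E') q) q (J q)))
    (hy : y ∈ (extChartAt 𝓘(ℝ, E') q).target) (a : E') :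
    ContDiffAt ℝ ∞ (fun z => chartEnd J q z a) y := by
  have ha := contMDiffAt_coordField hy a
  have hφ : ContMDiffAt 𝓘(ℝ, E') 𝓘(ℝ, E') ∞ (extChartAt 𝓘(ℝ, E') q).symm y :=
    (contMDiffOn_extChartAt_symm q).contMDiffAt ((isOpen_extChartAt_target q).mem_nhds hy)
  have h1 : ContMDiffAt 𝓘(ℝ, E') 𝓘(ℝ, E').tangent ∞
      (fun z => (TotalSpace.mk' E' ((extChartAt 𝓘(ℝ, E') q).symm z)
        (J _ (mfderiv 𝓘(ℝ, E') 𝓘(ℝ, E') (extChartAt 𝓘(ℝ, E') q).symm z a)) :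
          TangentBundle 𝓘(ℝ, E') N)) y := by
    apply ContMDiffAt.clm_bundle_apply (F₁ := E')
    · exact ContMDiffAt.comp y hJ.contMDiffAt hφ
    · exact ha
  have h2 := contMDiffAt_tangentMap (isOpen_extChartAt_source (I := 𝓘(ℝ, E')) q)
    (extChartAt_source (I := 𝓘(ℝ, E')) q ▸ contMDiffOn_extChartAt) h1 ((extChartAt 𝓘(ℝ, E') q).map_target hy)
  exact ((contMDiff_snd_tangentBundle_modelSpace E' 𝓘(ℝ, E')).contMDiffAt.comp y h2).contDiffAt

theorem eq_zero_of_mfderiv_symm_eq_zero (hy : y ∈ (extChartAt 𝓘(ℝ, E') q).target) {a : E'}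
    (h : mfderiv 𝓘(ℝ, E') 𝓘(ℝ, E') (extChartAt 𝓘(ℝ, E') q).symm y a = 0) : a = 0 :=
  ((mfderiv_extChartAt_mfderiv_symm hy a).symm.trans (congrArg _ h)).trans (map_zero _)

theorem contDiffAt_chartMetric (hy : y ∈ (extChartAt 𝓘(ℝ, E') q).target) :
    ContDiffAt ℝ ∞ (chartMetric g q) y := by
  have h : ContDiffOn ℝ ∞ (chartMetric g q) (extChartAt 𝓘(ℝ, E') q).target := by
    rw [contDiffOn_clm_apply]
    intro a
    rw [contDiffOn_clm_apply]
    intro b y hy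
    exact (contDiffAt_chartMetric_apply g hy a b).contDiffWithinAt
  exact h.contDiffAt ((isOpen_extChartAt_target q).mem_nhds hy)

theorem chartMetric_symm (q : N) (y a b : E') : chartMetric g q y a b = chartMetric g q y b a :=
  g.symm ((extChartAt 𝓘(ℝ, E') q).symm y)
    (mfderiv 𝓘(ℝ, E') 𝓘(ℝ, E') (extChartAt 𝓘(ℝ, E') q).symm y a)
    (mfderiv 𝓘(ℝ, E') 𝓘(ℝ, E') (extChartAt 𝓘(ℝ, E') q).symm y b)

theorem chartMetric_pos (hy : y ∈ (extChartAt 𝓘(ℝ, E') q).target) {a : E'} (ha : a ≠ 0) :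
    0 < chartMetric g q y a a :=
  g.pos ((extChartAt 𝓘(ℝ, E') q).symm y)
    (mfderiv 𝓘(ℝ, E') 𝓘(ℝ, E') (extChartAt 𝓘(ℝ, E') q).symm y a)
    fun h => ha (eq_zero_of_mfderiv_symm_eq_zero hy h)

theorem isMetricOn_chartMetric (q : N) :
    IsMetricOn (chartMetric g q) (extChartAt 𝓘(ℝ, E') q).target :=
  ⟨isOpen_extChartAt_target q, fun _ hy => contDiffAt_chartMetric g hy,
    fun y _ => chartMetric_symm g q y, fun _ hy _ ha => chartMetric_pos g hy ha⟩

variable {g}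

theorem IsKahler.isKahlerOn (h : IsKahler g J) (q : N) :
    IsKahlerOn (chartMetric g q) (chartEnd J q) (extChartAt 𝓘(ℝ, E') q).target where
  metric := isMetricOn_chartMetric g q
  contDiffAt y hy := (contDiffOn_clm_apply.2 fun a y hy =>
    (contDiffAt_chartEnd_apply h.smooth hy a).contDiffWithinAt).contDiffAt
      ((isOpen_extChartAt_target q).mem_nhds hy)
  sq y hy a := by
    have h1 := mfderiv_extChartAt_mfderiv_symm hy a
    conv_rhs => rw [← h1]
    change mfderiv 𝓘(ℝ, E') 𝓘(ℝ, E') (extChartAt 𝓘(ℝ, E') q) ((extChartAt 𝓘(ℝ, E') q).symm y)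
      (J _ (mfderiv 𝓘(ℝ, E') 𝓘(ℝ, E') (extChartAt 𝓘(ℝ, E') q).symm y
        (mfderiv 𝓘(ℝ, E') 𝓘(ℝ, E') (extChartAt 𝓘(ℝ, E') q) ((extChartAt 𝓘(ℝ, E') q).symm y) _))) = _
    erw [mfderiv_symm_mfderiv_extChartAt hy, h.sq]
    exact map_neg _ _
  hermitian y hy a b := by
    change g.inner _ (mfderiv 𝓘(ℝ, E') 𝓘(ℝ, E') (extChartAt 𝓘(ℝ, E') q).symm y
        (mfderiv 𝓘(ℝ, E') 𝓘(ℝ, E') (extChartAt 𝓘(ℝ, E') q) ((extChartAt 𝓘(ℝ, E') q).symm y) _))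
      (mfderiv 𝓘(ℝ, E') 𝓘(ℝ, E') (extChartAt 𝓘(ℝ, E') q).symm y
        (mfderiv 𝓘(ℝ, E') 𝓘(ℝ, E') (extChartAt 𝓘(ℝ, E') q) ((extChartAt 𝓘(ℝ, E') q).symm y) _)) = _
    erw [mfderiv_symm_mfderiv_extChartAt hy, mfderiv_symm_mfderiv_extChartAt hy]
    exact h.hermitian _ _ _
  parallel y hy v w := h.parallel q y hy v w

/-- At the centre of the preferred chart its derivative is the identity. This matches
`holomorphicCurv`, stated with `J q`, to the local hypotheses, stated with `chartEnd`. -/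
theorem chartEnd_self (J : ∀ q : N, TangentSpace 𝓘(ℝ, E') q →L[ℝ] TangentSpace 𝓘(ℝ, E') q) (q : N)
    (a : E') : chartEnd J q (extChartAt 𝓘(ℝ, E') q q) a = J q a := by
  have : IsManifold 𝓘(ℝ, E') 1 N := IsManifold.of_le (n := ∞) (by simp)
  -- The base point is generalized so that `symm (extChartAt q q) = q` can be substituted despite
  -- the dependent tangent spaces.
  have h1 : ∀ (q' : N) (b : E'), q' = q →
      (mfderiv 𝓘(ℝ, E') 𝓘(ℝ, E') (extChartAt 𝓘(ℝ, E') q) q' (J q' b) : E') = J q b := by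
    rintro q' b rfl
    rw [mfderiv_extChartAt_self]
    rfl
  have h2 : (mfderiv 𝓘(ℝ, E') 𝓘(ℝ, E') (extChartAt 𝓘(ℝ, E') q).symm (extChartAt 𝓘(ℝ, E') q q) a : E')
      = a := by
    have := mfderivWithin_range_extChartAt_symm (I := 𝓘(ℝ, E')) (x := q)
    rw [ModelWithCorners.range_eq_univ, mfderivWithin_univ] at this
    exact congrArg (fun T : E' →L[ℝ] E' => T a) this
  refine (h1 _ _ (extChartAt_to_inv q)).trans ?_
  exact congrArg (J q) h2

theorem chartMetric_mfderiv_extChartAt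
    (g : ContMDiffRiemannianMetric 𝓘(ℝ, E') ∞ E' (fun q : N => TangentSpace 𝓘(ℝ, E') q)) {r : N}
    (hr : r ∈ (extChartAt 𝓘(ℝ, E') q).source) (a b : TangentSpace 𝓘(ℝ, E') r) :
    chartMetric g q (extChartAt 𝓘(ℝ, E') q r)
      (mfderiv 𝓘(ℝ, E') 𝓘(ℝ, E') (extChartAt 𝓘(ℝ, E') q) r a)
      (mfderiv 𝓘(ℝ, E') 𝓘(ℝ, E') (extChartAt 𝓘(ℝ, E') q) r b) = g.inner r a b := by
  obtain ⟨y, hy, rfl⟩ : ∃ y ∈ (extChartAt 𝓘(ℝ, E') q).target, r = (extChartAt 𝓘(ℝ, E') q).symm y :=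
    ⟨_, (extChartAt 𝓘(ℝ, E') q).map_source hr, ((extChartAt 𝓘(ℝ, E') q).left_inv hr).symm⟩
  rw [(extChartAt 𝓘(ℝ, E') q).right_inv hy]
  have ha := mfderiv_symm_mfderiv_extChartAt hy a
  have hb := mfderiv_symm_mfderiv_extChartAt hy b
  exact congrArg₂ (fun a b => g.inner ((extChartAt 𝓘(ℝ, E') q).symm y) a b) ha hb

theorem chartEnd_mfderiv_extChartAt
    (J : ∀ q : N, TangentSpace 𝓘(ℝ, E') q →L[ℝ] TangentSpace 𝓘(ℝ, E') q) {r : N}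
    (hr : r ∈ (extChartAt 𝓘(ℝ, E') q).source) (a : TangentSpace 𝓘(ℝ, E') r) :
    chartEnd J q (extChartAt 𝓘(ℝ, E') q r)
      (mfderiv 𝓘(ℝ, E') 𝓘(ℝ, E') (extChartAt 𝓘(ℝ, E') q) r a) =
      mfderiv 𝓘(ℝ, E') 𝓘(ℝ, E') (extChartAt 𝓘(ℝ, E') q) r (J r a) := by
  obtain ⟨y, hy, rfl⟩ : ∃ y ∈ (extChartAt 𝓘(ℝ, E') q).target, r = (extChartAt 𝓘(ℝ, E') q).symm y :=
    ⟨_, (extChartAt 𝓘(ℝ, E') q).map_source hr, ((extChartAt 𝓘(ℝ, E') q).left_inv hr).symm⟩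
  rw [(extChartAt 𝓘(ℝ, E') q).right_inv hy]
  have ha := mfderiv_symm_mfderiv_extChartAt hy a
  exact congrArg (fun a => mfderiv 𝓘(ℝ, E') 𝓘(ℝ, E') (extChartAt 𝓘(ℝ, E') q)
    ((extChartAt 𝓘(ℝ, E') q).symm y) (J ((extChartAt 𝓘(ℝ, E') q).symm y) a)) ha

/-- The coordinate domain on which `F` is read in the preferred charts at `p` and `F p`. -/
def chartDomain (E' : Type*) [NormedAddCommGroup E'] [NormedSpace ℝ E'] {N : Type*}
    [TopologicalSpace N] [ChartedSpace E' N] (F : M → N) (p : M) : Set E :=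
  (extChartAt 𝓘(ℝ, E) p).target ∩
    (extChartAt 𝓘(ℝ, E) p).symm ⁻¹' (F ⁻¹' (extChartAt 𝓘(ℝ, E') (F p)).source)

variable {F : M → N} {p : M} {x : E}

theorem isOpen_chartDomain (hF : ContMDiff 𝓘(ℝ, E) 𝓘(ℝ, E') ∞ F) (p : M) :
    IsOpen (chartDomain (E := E) E' F p) :=
  (continuousOn_extChartAt_symm p).isOpen_inter_preimage (isOpen_extChartAt_target p)
    ((isOpen_extChartAt_source (I := 𝓘(ℝ, E')) (F p)).preimage hF.continuous)

theorem contMDiffAt_writtenInExtChartAt (hF : ContMDiff 𝓘(ℝ, E) 𝓘(ℝ, E') ∞ F)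
    (hx : x ∈ chartDomain (E := E) E' F p) :
    ContMDiffAt 𝓘(ℝ, E) 𝓘(ℝ, E') ∞ (writtenInExtChartAt 𝓘(ℝ, E) 𝓘(ℝ, E') p F) x := by
  have h1 : ContMDiffAt 𝓘(ℝ, E) 𝓘(ℝ, E) ∞ (extChartAt 𝓘(ℝ, E) p).symm x :=
    (contMDiffOn_extChartAt_symm p).contMDiffAt ((isOpen_extChartAt_target p).mem_nhds hx.1)
  have h2 : ContMDiffAt 𝓘(ℝ, E') 𝓘(ℝ, E') ∞ (extChartAt 𝓘(ℝ, E') (F p))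
      (F ((extChartAt 𝓘(ℝ, E) p).symm x)) :=
    contMDiffAt_extChartAt' (by simpa [extChartAt_source] using hx.2)
  exact h2.comp x (hF.contMDiffAt.comp x h1)

theorem fderiv_writtenInExtChartAt (hF : ContMDiff 𝓘(ℝ, E) 𝓘(ℝ, E') ∞ F)
    (hx : x ∈ chartDomain (E := E) E' F p) (v : E) :
    fderiv ℝ (writtenInExtChartAt 𝓘(ℝ, E) 𝓘(ℝ, E') p F) x v =
      mfderiv 𝓘(ℝ, E') 𝓘(ℝ, E') (extChartAt 𝓘(ℝ, E') (F p)) (F ((extChartAt 𝓘(ℝ, E) p).symm x))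
        (mfderiv 𝓘(ℝ, E) 𝓘(ℝ, E') F ((extChartAt 𝓘(ℝ, E) p).symm x)
          (mfderiv 𝓘(ℝ, E) 𝓘(ℝ, E) (extChartAt 𝓘(ℝ, E) p).symm x v)) := by
  have h1 : ContMDiffAt 𝓘(ℝ, E) 𝓘(ℝ, E) ∞ (extChartAt 𝓘(ℝ, E) p).symm x :=
    (contMDiffOn_extChartAt_symm p).contMDiffAt ((isOpen_extChartAt_target p).mem_nhds hx.1)
  have h2 : ContMDiffAt 𝓘(ℝ, E') 𝓘(ℝ, E') ∞ (extChartAt 𝓘(ℝ, E') (F p))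
      (F ((extChartAt 𝓘(ℝ, E) p).symm x)) :=
    contMDiffAt_extChartAt' (by simpa [extChartAt_source] using hx.2)
  have h3 := (h2.mdifferentiableAt (by simp)).hasMFDerivAt.comp x
    ((hF.contMDiffAt.mdifferentiableAt (by simp)).hasMFDerivAt.comp x
      (h1.mdifferentiableAt (by simp)).hasMFDerivAt)
  rw [← mfderiv_eq_fderiv]
  change mfderiv 𝓘(ℝ, E) 𝓘(ℝ, E') (extChartAt 𝓘(ℝ, E') (F p) ∘ F ∘ (extChartAt 𝓘(ℝ, E) p).symm) x v
    = _
  rw [h3.mfderiv]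
  rfl

theorem mem_chartDomain (F : M → N) (p : M) :
    extChartAt 𝓘(ℝ, E) p p ∈ chartDomain (E := E) E' F p :=
  ⟨mem_extChartAt_target p, by simp⟩

theorem isImmersionInto_writtenInExtChartAt
    (hF : IsSmoothImmersion (E := E) (E' := E') F) (p : M) :
    IsImmersionInto (writtenInExtChartAt 𝓘(ℝ, E) 𝓘(ℝ, E') p F) (chartDomain (E := E) E' F p)
      (extChartAt 𝓘(ℝ, E') (F p)).target where
  isOpen := isOpen_chartDomain hF.1 p
  contDiffAt x hx := (contMDiffAt_writtenInExtChartAt hF.1 hx).contDiffAt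
  mapsTo x hx := (extChartAt 𝓘(ℝ, E') (F p)).map_source hx.2
  injective x hx := by
    rw [injective_iff_map_eq_zero]
    intro v hv
    rw [fderiv_writtenInExtChartAt hF.1 hx] at hv
    have : IsManifold 𝓘(ℝ, E') 1 N := IsManifold.of_le (n := ∞) (by simp)
    have h1 := (isInvertible_mfderiv_extChartAt (I := 𝓘(ℝ, E')) hx.2).injective
      (hv.trans (map_zero _).symm)
    exact eq_zero_of_mfderiv_symm_eq_zero hx.1 (hF.2 _ (h1.trans (map_zero _).symm))

theorem IsTotallyReal.isTotallyRealAt (hK : IsKahler g J)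
    (hF : IsSmoothImmersion (E := E) (E' := E') F) (hreal : IsTotallyReal (E := E) g J F)
    (hf : HasParallelF (E := E) g J F) (p : M) :
    IsTotallyRealAt (chartMetric g (F p)) (chartEnd J (F p)) (extChartAt 𝓘(ℝ, E') (F p)).target
      (writtenInExtChartAt 𝓘(ℝ, E) 𝓘(ℝ, E') p F) (chartDomain (E := E) E' F p)
      (extChartAt 𝓘(ℝ, E) p p) where
  kahler := hK.isKahlerOn (F p)
  immersion := isImmersionInto_writtenInExtChartAt hF p
  mem := mem_chartDomain F p
  real v w := by
    have hx := mem_chartDomain (E := E) (E' := E') F p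
    rw [fderiv_writtenInExtChartAt hF.1 hx, fderiv_writtenInExtChartAt hF.1 hx]
    refine (congrArg (fun c => chartMetric g (F p) _ c _)
      (chartEnd_mfderiv_extChartAt J hx.2 _)).trans ?_
    exact (chartMetric_mfderiv_extChartAt g hx.2 _ _).trans (hreal _ _ _)
  parallel := hf p

end Charts

/-! ### Holomorphic sectional curvature along the immersion. -/

section ComplexSpaceForms

variable {E : Type*} [NormedAddCommGroup E] [NormedSpace ℝ E] [FiniteDimensional ℝ E]
variable {M : Type*} [TopologicalSpace M] [ChartedSpace E M] [IsManifold 𝓘(ℝ, E) ∞ M]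
variable {E' : Type*} [NormedAddCommGroup E'] [NormedSpace ℝ E'] [FiniteDimensional ℝ E']
variable {N : Type*} [TopologicalSpace N] [ChartedSpace E' N] [IsManifold 𝓘(ℝ, E') ∞ N]
variable {g : ContMDiffRiemannianMetric 𝓘(ℝ, E') ∞ E' (fun q : N => TangentSpace 𝓘(ℝ, E') q)}
  {J : ∀ q : N, TangentSpace 𝓘(ℝ, E') q →L[ℝ] TangentSpace 𝓘(ℝ, E') q} {μ : ℝ}

theorem IsComplexSpaceForm.sectionalCurv_eq (hN : IsComplexSpaceForm g J μ) (F : M → N) (p : M)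
    (a : E') (ha : a ≠ 0) :
    sectionalCurv (chartMetric g (F p))
      (writtenInExtChartAt 𝓘(ℝ, E) 𝓘(ℝ, E') p F (extChartAt 𝓘(ℝ, E) p p)) a
      (chartEnd J (F p) (writtenInExtChartAt 𝓘(ℝ, E) 𝓘(ℝ, E') p F (extChartAt 𝓘(ℝ, E) p p)) a)
      = μ := by
  have h : writtenInExtChartAt 𝓘(ℝ, E) 𝓘(ℝ, E') p F (extChartAt 𝓘(ℝ, E) p p) =
      extChartAt 𝓘(ℝ, E') (F p) (F p) := by
    simp [writtenInExtChartAt]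
  rw [h, chartEnd_self]
  exact hN.holomorphicCurv (F p) a ha

end ComplexSpaceForms

end TotReal

end

theorem theorem2
    {E : Type*} [NormedAddCommGroup E] [NormedSpace ℝ E] [FiniteDimensional ℝ E]
    {M : Type*} [TopologicalSpace M] [ChartedSpace E M] [IsManifold 𝓘(ℝ, E) ∞ M]
    {E' : Type*} [NormedAddCommGroup E'] [NormedSpace ℝ E'] [FiniteDimensional ℝ E']
    {N : Type*} [TopologicalSpace N] [ChartedSpace E' N] [IsManifold 𝓘(ℝ, E') ∞ N]
    (g : ContMDiffRiemannianMetric 𝓘(ℝ, E') ∞ E' (fun q : N => TangentSpace 𝓘(ℝ, E') q))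
    (J : ∀ q : N, TangentSpace 𝓘(ℝ, E') q →L[ℝ] TangentSpace 𝓘(ℝ, E') q)
    (μ : ℝ) (hN : TotReal.IsComplexSpaceForm g J μ)
    (F : M → N) (hF : TotReal.IsSmoothImmersion (E := E) (E' := E') F)
    (hreal : TotReal.IsTotallyReal (E := E) g J F)
    (hmin : TotReal.IsMinimal (E := E) g F)
    (hsemi : TotReal.IsSemiparallel (E := E) g F)
    (hf : TotReal.HasParallelF (E := E) g J F) :
    ((∃ c : ℝ, ∀ p : M, TotReal.sffLengthSq (E := E) g F p = c) ↔
      (∃ c : ℝ, ∀ p : M, TotReal.scalarCurvature (E := E) g F p = c)) ∧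
    ((∃ c : ℝ, ∀ p : M, TotReal.sffLengthSq (E := E) g F p = c) →
      (TotReal.IsTotallyGeodesic (E := E) g F ∨
        ∀ p : M, 0 ≤ TotReal.scalarCurvature (E := E) g F p) ∧
      ((∀ p : M, TotReal.scalarCurvature (E := E) g F p = 0) → TotReal.IsFlat (E := E) g F)) := by
  have hR := fun p => TotReal.IsTotallyReal.isTotallyRealAt hN.kahler hF hreal hf p
  have hol := fun p => hN.sectionalCurv_eq (E := E) F p
  -- The traced Gauss equation, `τ + ‖σ‖² = n(n-1) μ / 4`, is already the equivalence.
  have hτ : ∀ p, TotReal.scalarCurvature (E := E) g F p =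
      Module.finrank ℝ E * (Module.finrank ℝ E - 1) * (μ / 4)
        - TotReal.sffLengthSq (E := E) g F p := by
    intro p
    obtain ⟨e, he⟩ := (hR p).induced.exists_isOrthonormalFor (hR p).mem
    have := (hR p).scalarCurv_eq he (hol p) (hmin p)
    rwa [Fintype.card_fin] at this
  refine ⟨⟨fun ⟨c, hc⟩ => ⟨_, fun p => by rw [hτ, hc]⟩, fun ⟨c, hc⟩ =>
    ⟨Module.finrank ℝ E * (Module.finrank ℝ E - 1) * (μ / 4) - c, fun p => by
      rw [← hc p, hτ, sub_sub_cancel]⟩⟩, fun ⟨c, hc⟩ => ⟨?_, fun h0 p v w z =>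
    (hR p).curv_eq_zero (hol p) (hmin p) (hsemi p) (h0 p) v w z⟩⟩
  -- Constancy enters here: `σ` vanishes at every point, or is nonzero at every point, where the
  -- pointwise inequality applies.
  by_cases hc0 : c = 0
  · exact Or.inl fun p v w => (hR p).sff_eq_zero ((hc p).trans hc0) v w
  · exact Or.inr fun p => (hR p).scalarCurv_nonneg (hol p) (hmin p) (hsemi p)
      fun h => hc0 ((hc p).symm.trans h)
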